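/- Let $\Omega=\{\omega\in C(\mathbb R,\mathbb R):\omega(0)=0\}$ with the Borel $\sigma$-algebra of the compact-open topology, let $P$ be the two-sided Wiener measure on $\Omega$, and let $\theta_t\omega(\cdot)=\omega(\cdot+t)-\omega(t)$. Let $\delta>0$. For $\lambda\in\mathbb R$ and a smooth $\beta:\mathbb R\to\mathbb R$ for which there are $\beta_1\ge\beta_0>0$ with $\beta_0\le\beta(t)\le\beta_1$ for all $t\in\mathbb R$, consider the Stratonovich equation $$dx=(\lambda x-\beta(t)x^2)\,dt+\delta x\circ d\omega,\qquad x(\tau)=x_0 .\tag{1}$$ A solution of (1) on $[\tau,T]$ along $\omega$ is a continuous $x:[\tau,T]\to\mathbb R$ with $x(t)=x_0+\int_\tau^t(\lambda x(s)-\beta(s)x(s)^2)\,ds+\delta\int_\tau^t x\circ d\omega$ for $t\in[\tau,T]$, where $\int_\tau^t x\circ d\omega$ is the limit of $\sum_i\frac{x(u_i)+x(u_{i+1})}2(\omega(u_{i+1})-\omega(u_i))$ as the mesh of the partition $\tau=u_0\le\dots\le u_n=t$ tends to $0$, and is required to exist. Let $x(t,\tau,\omega,x_0)$ denote the value at $t$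 of the solution, where it exists, and $\Phi(t,\tau,\omega,x_0)=x(t+\tau,\tau,\theta_{-\tau}\omega,x_0)$ for $t\ge0$. Set $$x_\lambda(\tau,\omega)=\Big(\int_{-\infty}^0e^{\lambda r+\delta\omega(r)}\beta(r+\tau)\,dr\Big)^{-1}\ (\lambda>0),\qquad x_\lambda(\tau,\omega)=-\Big(\int_0^{\infty}e^{\lambda r+\delta\omega(r)}\beta(r+\tau)\,dr\Big)^{-1}\ (\lambda<0).$$ Then there is a set $\tilde\Omega\subseteq\Omega$ of full $P$-measure, depending only on $\delta$ (not on $\beta$ or $\lambda$), invariant under every $\theta_t$, such that for all $\beta$ as above the following hold. For all $\lambda\in\mathbb R$, $\omega\in\tilde\Omega$ and $\tau\le T$, solutions of (1) on $[\tau,T]$ are unique for every $x_0\in\mathbb R$ and exist for every $x_0\ge0$. Moreover, (1) undergoes a transcritical bifurcation at $\lambda=0$ in the following sense. Here a random complete quasi-solution is a map $\xi:\mathbb R\times\Omega\to\mathbb R$ with $\xi(\tau,\cdot)$ measurable such that for all $t\ge0$, $\tau\in\mathbb R$, $\omega\in\tilde\Omega$ the solution defining $\Phi(t,\tau,\omega,\xi(\tau,\omega))$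 exists on $[\tau,\tau+t]$ and $\Phi(t,\tau,\omega,\xi(\tau,\omega))=\xi(\tau+t,\theta_t\omega)$. (i) For every $\lambda<0$, both $0$ and $x_\lambda$ are random complete quasi-solutions, and $x_\lambda(\tau,\omega)<0$ for all $\tau\in\mathbb R$, $\omega\in\tilde\Omega$. The zero solution is pullback asymptotically stable in $(0,\infty)$: for all $\tau\in\mathbb R$, $\omega\in\tilde\Omega$ and $\varepsilon>0$ there is $\eta>0$ with $\Phi(t,\tau-t,\theta_{-t}\omega,x_0)\in(0,\varepsilon)$ for all $t\ge0$ and $x_0\in(0,\eta)$, and $\Phi(t,\tau-t,\theta_{-t}\omega,x_0)\to0$ as $t\to\infty$ for every $x_0>0$. It pullback attracts every compact $K\subset(0,\infty)$: $\sup_{x_0\in K}|\Phi(t,\tau-t,\theta_{-t}\omega,x_0)|\to0$ as $t\to\infty$, for all $\tau\in\mathbb R$, $\omega\in\tilde\Omega$. Furthermore $\lim_{\lambda\to0^-}x_\lambda(\tau,\omega)=0$ for all $\tau\in\mathbb R$, $\omega\in\tilde\Omega$. (ii) For every $\lambda>0$, both $0$ and $x_\lambda$ are random complete quasi-solutions,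 and $x_\lambda(\tau,\omega)>0$ for all $\tau\in\mathbb R$, $\omega\in\tilde\Omega$. The zero solution is pullback Lyapunov unstable in $(0,\infty)$: for every $\tau\in\mathbb R$ and $\omega\in\tilde\Omega$ there is $\varepsilon>0$ for which no $\eta>0$ has the property in (i). The quasi-solution $x_\lambda$ pullback attracts every compact $K\subset(0,\infty)$: $\sup_{x_0\in K}|\Phi(t,\tau-t,\theta_{-t}\omega,x_0)-x_\lambda(\tau,\omega)|\to0$ as $t\to\infty$, for all $\tau\in\mathbb R$, $\omega\in\tilde\Omega$. Furthermore $\lim_{\lambda\to0^+}x_\lambda(\tau,\omega)=0$ for all $\tau\in\mathbb R$, $\omega\in\tilde\Omega$. -/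

import Mathlib

open MeasureTheory ProbabilityTheory Filter Topology

/-- The path space `{ω ∈ C(ℝ, ℝ) : ω 0 = 0}` with the (subspace of the) compact-open topology. -/
abbrev PathSpace : Type := {ω : C(ℝ, ℝ) // ω 0 = 0}

/-- The Borel `σ`-algebra of the compact-open topology. -/
instance instMeasurableSpacePathSpace : MeasurableSpace PathSpace := borel PathSpace

instance instBorelSpacePathSpace : BorelSpace PathSpace := ⟨rfl⟩

/-- The two-sided Wiener measure on path space: under `P` the canonical process
(which vanishes at time `0`) has independent increments over the whole real line, and
`ω t - ω s` is centred Gaussian with variance `t - s` for `s ≤ t`. -/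
structure IsWienerMeasure (P : Measure PathSpace) : Prop where
  isProbabilityMeasure : IsProbabilityMeasure P
  indep_increments : HasIndepIncrements (fun (t : ℝ) (ω : PathSpace) => ω.1 t) P
  gaussian_increments : ∀ s t : ℝ, s ≤ t →
    P.map (fun ω : PathSpace => ω.1 t - ω.1 s) = gaussianReal 0 (t - s).toNNReal

/-- The Wiener shift `(θ_t ω)(s) = ω (s + t) - ω t`. -/
def wienerShift (t : ℝ) (ω : PathSpace) : PathSpace :=
  ⟨⟨fun s => ω.1 (s + t) - ω.1 t, by fun_prop⟩, by simp⟩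

/-- `I` is the Stratonovich integral `∫_a^b x ∘ dw`: the limit, as the mesh of the partition
`a = u 0 ≤ u 1 ≤ ⋯ ≤ u n = b` tends to zero, of the symmetric (trapezoidal) sums
`∑ (x (u i) + x (u (i+1))) / 2 * (w (u (i+1)) - w (u i))`. The limit is taken path by path;
when it exists for almost every path it is in particular the limit in probability. -/
def HasStratonovichIntegral (x w : ℝ → ℝ) (a b I : ℝ) : Prop :=
  ∀ ε > 0, ∃ η > 0, ∀ (n : ℕ) (u : ℕ → ℝ), u 0 = a → u n = b →
    (∀ i < n, u i ≤ u (i + 1) ∧ u (i + 1) - u i < η) →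
    |(∑ i ∈ Finset.range n, (x (u i) + x (u (i + 1))) / 2 * (w (u (i + 1)) - w (u i))) - I| < ε

/-- `x` is, on `[a, b]`, a (non-exploding) solution with `x a = x₀` of the Stratonovich equation
`dx = (lam x - β(t) x²) dt + δ x ∘ dω`, in integrated form. -/
structure IsStratonovichSolution (lam δ : ℝ) (β : ℝ → ℝ) (ω : PathSpace) (a b x₀ : ℝ)
    (x : ℝ → ℝ) : Prop where
  continuousOn : ContinuousOn x (Set.Icc a b)
  initial : x a = x₀
  integral_eq : ∀ t ∈ Set.Icc a b, ∃ I : ℝ, HasStratonovichIntegral x (fun s => ω.1 s) a t I ∧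
    x t = x₀ + (∫ s in a..t, (lam * x s - β s * x s ^ 2)) + δ * I

/-- There is a solution on `[a, b]` starting from `x₀` at time `a`. -/
def SolutionExists (lam δ : ℝ) (β : ℝ → ℝ) (ω : PathSpace) (a b x₀ : ℝ) : Prop :=
  ∃ x : ℝ → ℝ, IsStratonovichSolution lam δ β ω a b x₀ x

open scoped Classical in
/-- The solution operator: `solution lam δ β t τ ω x₀` is the value at time `t` of a
solution starting from `x₀` at time `τ`. It is used only where a solution exists on `[τ, t]`
and is unique; otherwise the value `0` is a placeholder without meaning. -/
noncomputable def solution (lam δ : ℝ) (β : ℝ → ℝ) (t τ : ℝ) (ω : PathSpace) (x₀ : ℝ) : ℝ :=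
  if h : SolutionExists lam δ β ω τ t x₀ then h.choose t else 0

/-- The cocycle `Φ(t, τ, ω, x₀) = x(t + τ, τ, θ_{-τ} ω, x₀)`. -/
noncomputable def solutionCocycle (lam δ : ℝ) (β : ℝ → ℝ) (t τ : ℝ) (ω : PathSpace) (x₀ : ℝ) : ℝ :=
  solution lam δ β (t + τ) τ (wienerShift (-τ) ω) x₀

/-- `ξ` is a random complete quasi-solution: `ξ (τ, ·)` is measurable, and for every `t ≥ 0` the
solution started from `ξ (τ, ω)` exists up to elapsed time `t` and satisfies
`Φ(t, τ, ω, ξ(τ, ω)) = ξ(τ + t, θ_t ω)`. Here `Ω'` is the set of paths under consideration. -/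
structure IsRandomCompleteQuasiSolution (lam δ : ℝ) (β : ℝ → ℝ) (Ω' : Set PathSpace)
    (ξ : ℝ → PathSpace → ℝ) : Prop where
  measurable : ∀ τ : ℝ, Measurable (ξ τ)
  exists_solution : ∀ t ≥ (0 : ℝ), ∀ τ : ℝ, ∀ ω ∈ Ω',
    SolutionExists lam δ β (wienerShift (-τ) ω) τ (t + τ) (ξ τ ω)
  invariant : ∀ t ≥ (0 : ℝ), ∀ τ : ℝ, ∀ ω ∈ Ω',
    solutionCocycle lam δ β t τ ω (ξ τ ω) = ξ (τ + t) (wienerShift t ω)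

/-- The pullback Lyapunov stability condition for the point `p` in `E` at the fibre `(τ, ω)`:
for every `ε > 0` there is `η > 0` with
`Φ(t, τ - t, θ_{-t} ω, N_η(p) ∩ E) ⊆ N_ε(p) ∩ E` for all `t ≥ 0`. -/
def PullbackLyapunovStableAt (Φ : ℝ → ℝ → PathSpace → ℝ → ℝ) (p : ℝ) (E : Set ℝ)
    (τ : ℝ) (ω : PathSpace) : Prop :=
  ∀ ε > 0, ∃ η > 0, ∀ t ≥ (0 : ℝ), ∀ x ∈ Metric.ball p η ∩ E,
    Φ t (τ - t) (wienerShift (-t) ω) x ∈ Metric.ball p ε ∩ E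

/-- Pullback asymptotic stability of `p` in `E`: Lyapunov stability on every fibre, together with
`Φ(t, τ - t, θ_{-t} ω, x) → p` as `t → ∞` for every `x ∈ E`. -/
def PullbackAsymptoticallyStable (Φ : ℝ → ℝ → PathSpace → ℝ → ℝ) (p : ℝ) (E : Set ℝ)
    (Ω' : Set PathSpace) : Prop :=
  (∀ τ : ℝ, ∀ ω ∈ Ω', PullbackLyapunovStableAt Φ p E τ ω) ∧
  ∀ τ : ℝ, ∀ ω ∈ Ω', ∀ x ∈ E,
    Tendsto (fun t : ℝ => Φ t (τ - t) (wienerShift (-t) ω) x) atTop (𝓝 p)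

/-- `ξ` pullback attracts the set `K`: `sup_{x ∈ K} |Φ(t, τ - t, θ_{-t} ω, x) - ξ(τ, ω)| → 0`
as `t → ∞`, for all `τ` and all `ω ∈ Ω'`. -/
def PullbackAttracts (Φ : ℝ → ℝ → PathSpace → ℝ → ℝ) (ξ : ℝ → PathSpace → ℝ) (K : Set ℝ)
    (Ω' : Set PathSpace) : Prop :=
  ∀ τ : ℝ, ∀ ω ∈ Ω', ∀ ε > 0, ∀ᶠ t : ℝ in atTop, ∀ x ∈ K,
    |Φ t (τ - t) (wienerShift (-t) ω) x - ξ τ ω| < ε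

/-- The explicit process `x_lam (τ, ω)`, defined for `lam ≠ 0` (the value at `lam = 0` is a
placeholder). -/
noncomputable def bifurcatingSolution (lam δ : ℝ) (β : ℝ → ℝ) (τ : ℝ) (ω : PathSpace) : ℝ :=
  if 0 < lam then (∫ r in Set.Iic (0 : ℝ), Real.exp (lam * r + δ * ω.1 r) * β (r + τ))⁻¹
  else if lam < 0 then -(∫ r in Set.Ioi (0 : ℝ), Real.exp (lam * r + δ * ω.1 r) * β (r + τ))⁻¹
  else 0

/-- `S` is the sum of the interval function `Q` over a partition of `[a, b]` of mesh less than
`η`. -/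
inductive FineSum (Q : ℝ → ℝ → ℝ) (η : ℝ) : ℝ → ℝ → ℝ → Prop
  | nil (a : ℝ) : FineSum Q η a a 0
  | cons {a c b S : ℝ} : a ≤ c → c - a < η → FineSum Q η c b S → FineSum Q η a b (Q a c + S)

/-- The summand of the symmetric Riemann sums that define the Stratonovich integral. -/
noncomputable def trapezoid (x w : ℝ → ℝ) (s t : ℝ) : ℝ := (x s + x t) / 2 * (w t - w s)

namespace FineSum

variable {Q : ℝ → ℝ → ℝ} {η : ℝ}

lemma trans {a c b S T : ℝ} (h₁ : FineSum Q η a c S) (h₂ : FineSum Q η c b T) :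
    FineSum Q η a b (S + T) := by
  induction h₁ with
  | nil a => simpa using h₂
  | cons hac hη _ ih => rw [add_assoc]; exact cons hac hη (ih h₂)

lemma mono {η' : ℝ} (h : η ≤ η') {a b S : ℝ} (hS : FineSum Q η a b S) : FineSum Q η' a b S := by
  induction hS with
  | nil a => exact nil a
  | cons hac hη _ ih => exact cons hac (hη.trans_le h) ih

lemma single {a b : ℝ} (hab : a ≤ b) (h : b - a < η) : FineSum Q η a b (Q a b) := by
  simpa using cons hab h (nil b)

lemma exists_of_le (Q : ℝ → ℝ → ℝ) (hη : 0 < η) {a b : ℝ} (hab : a ≤ b) :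
    ∃ S, FineSum Q η a b S := by
  obtain ⟨n, hn⟩ := exists_nat_ge ((b - a) / (η / 2))
  rw [div_le_iff₀ (by positivity)] at hn
  induction n generalizing a with
  | zero =>
    have : a = b := by simp at hn; linarith
    subst this; exact ⟨0, nil a⟩
  | succ n ih =>
    by_cases h : b - a < η
    · exact ⟨_, single hab h⟩
    · obtain ⟨S, hS⟩ := ih (a := a + η / 2) (by linarith) (by push_cast at hn; linarith)
      exact ⟨_, cons (by linarith) (by linarith) hS⟩

lemma of_seq (n : ℕ) (u : ℕ → ℝ) (hu : ∀ i < n, u i ≤ u (i + 1) ∧ u (i + 1) - u i < η) :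
    FineSum Q η (u 0) (u n) (∑ i ∈ Finset.range n, Q (u i) (u (i + 1))) := by
  induction n with
  | zero => simpa using nil _
  | succ n ih =>
    rw [Finset.sum_range_succ]
    exact (ih fun i hi => hu i (by omega)).trans (single (hu n (by omega)).1 (hu n (by omega)).2)

lemma exists_seq {a b S : ℝ} (hS : FineSum Q η a b S) :
    ∃ (n : ℕ) (u : ℕ → ℝ), u 0 = a ∧ u n = b ∧
      (∀ i < n, u i ≤ u (i + 1) ∧ u (i + 1) - u i < η) ∧
      ∑ i ∈ Finset.range n, Q (u i) (u (i + 1)) = S := by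
  induction hS with
  | nil a => exact ⟨0, fun _ => a, rfl, rfl, by simp, by simp⟩
  | @cons a c b S hac hη _ ih =>
    obtain ⟨n, u, h0, hn, hu, hs⟩ := ih
    refine ⟨n + 1, fun i => Nat.casesOn i a u, rfl, hn, ?_, ?_⟩
    · rintro (_ | i) hi
      · simpa [h0] using ⟨hac, hη⟩
      · exact hu i (by omega)
    · rw [Finset.sum_range_succ']
      simp only [h0, ← hs]
      exact add_comm _ _

end FineSum

lemma hasStratonovichIntegral_iff {x w : ℝ → ℝ} {a b I : ℝ} :
    HasStratonovichIntegral x w a b I ↔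
      ∀ ε > 0, ∃ η > 0, ∀ S, FineSum (trapezoid x w) η a b S → |S - I| < ε := by
  constructor
  · intro h ε hε
    obtain ⟨η, hη, H⟩ := h ε hε
    refine ⟨η, hη, fun S hS => ?_⟩
    obtain ⟨n, u, h0, hn, hu, rfl⟩ := hS.exists_seq
    exact H n u h0 hn hu
  · intro h ε hε
    obtain ⟨η, hη, H⟩ := h ε hε
    refine ⟨η, hη, fun n u h0 hn hu => H _ ?_⟩
    subst h0 hn
    exact FineSum.of_seq n u hu

lemma le_of_forall_le_succ {n : ℕ} {u : ℕ → ℝ} (hu : ∀ i < n, u i ≤ u (i + 1)) :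
    ∀ i ≤ n, ∀ j ≤ i, u j ≤ u i := by
  intro i
  induction i with
  | zero => intro _ j hj; rw [Nat.le_zero.1 hj]
  | succ i ih =>
    intro hi j hj
    rcases Nat.le_succ_iff.1 hj with h | h
    · exact (ih (by omega) j h).trans (hu i (by omega))
    · rw [h]

namespace HasStratonovichIntegral

variable {x w : ℝ → ℝ}

lemma self_eq_zero {a I : ℝ} (h : HasStratonovichIntegral x w a a I) : I = 0 := by
  by_contra hI
  obtain ⟨η, -, H⟩ := hasStratonovichIntegral_iff.1 h |I| (abs_pos.2 hI)
  simpa using H 0 (.nil a)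

lemma exists_fineSum {a c d I J : ℝ} (hac : a ≤ c) (hcd : c ≤ d)
    (hI : HasStratonovichIntegral x w a c I) (hJ : HasStratonovichIntegral x w a d J)
    {ε η : ℝ} (hε : 0 < ε) (hη : 0 < η) :
    ∃ S, FineSum (trapezoid x w) η c d S ∧ |S - (J - I)| ≤ ε := by
  obtain ⟨η₁, h₁, H₁⟩ := hasStratonovichIntegral_iff.1 hI (ε / 2) (by positivity)
  obtain ⟨η₂, h₂, H₂⟩ := hasStratonovichIntegral_iff.1 hJ (ε / 2) (by positivity)
  have hμ : 0 < min η (min η₁ η₂) := by positivity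
  obtain ⟨S₁, hS₁⟩ := FineSum.exists_of_le (trapezoid x w) hμ hac
  obtain ⟨S, hS⟩ := FineSum.exists_of_le (trapezoid x w) hμ hcd
  refine ⟨S, hS.mono (min_le_left _ _), ?_⟩
  have a₁ := H₁ S₁ (hS₁.mono ((min_le_right _ _).trans (min_le_left _ _)))
  have a₂ := H₂ _ ((hS₁.trans hS).mono ((min_le_right _ _).trans (min_le_right _ _)))
  rw [abs_lt] at a₁ a₂
  rw [abs_le]
  constructor <;> linarith

/-- The Saks–Henstock lemma for the Stratonovich integral. -/
lemma saks_henstock {a b : ℝ} {I : ℝ → ℝ} (hab : a ≤ b)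
    (hI : ∀ t ∈ Set.Icc a b, HasStratonovichIntegral x w a t (I t)) {ε : ℝ} (hε : 0 < ε) :
    ∃ η > 0, ∀ (n : ℕ) (u : ℕ → ℝ), u 0 = a → u n = b →
      (∀ i < n, u i ≤ u (i + 1) ∧ u (i + 1) - u i < η) →
      ∑ i ∈ Finset.range n, |trapezoid x w (u i) (u (i + 1)) - (I (u (i + 1)) - I (u i))| ≤ ε := by
  obtain ⟨η, hη, H⟩ := hasStratonovichIntegral_iff.1 (hI b ⟨hab, le_rfl⟩) (ε / 2) (by positivity)
  refine ⟨η, hη, fun n u h0 hn hu => ?_⟩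
  have hmem : ∀ i ≤ n, u i ∈ Set.Icc a b := fun i hi =>
    ⟨h0 ▸ le_of_forall_le_succ (fun i hi => (hu i hi).1) i hi 0 (Nat.zero_le _),
      hn ▸ le_of_forall_le_succ (fun i hi => (hu i hi).1) n le_rfl i hi⟩
  set e : ℕ → ℝ := fun i => trapezoid x w (u i) (u (i + 1)) - (I (u (i + 1)) - I (u i)) with he
  have key : ∀ (p : ℕ → Prop) [DecidablePred p] (ε' : ℝ), 0 < ε' → ∀ k ≤ n,
      ∃ S, FineSum (trapezoid x w) η a (u k) S ∧
        |S - (I (u k) + ∑ i ∈ Finset.range k, if p i then e i else 0)| ≤ k * ε' := by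
    intro p _ ε' hε' k
    induction k with
    | zero =>
      intro _
      have : I a = 0 := (hI a ⟨le_rfl, hab⟩).self_eq_zero
      exact ⟨0, by rw [h0]; exact .nil a, by simp [h0, this]⟩
    | succ k ih =>
      intro hk
      obtain ⟨S, hS, hS'⟩ := ih (by omega)
      rw [Finset.sum_range_succ]
      by_cases hp : p k
      · refine ⟨_, hS.trans (.single (hu k (by omega)).1 (hu k (by omega)).2), ?_⟩
        rw [if_pos hp]
        rw [abs_le] at hS' ⊢
        push_cast
        simp only [he] at hS' ⊢
        constructor <;> linarith
      · obtain ⟨T, hT, hT'⟩ := exists_fineSum (hmem k (by omega)).1 (hu k (by omega)).1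
          (hI _ (hmem k (by omega))) (hI _ (hmem (k + 1) hk)) hε' hη
        refine ⟨_, hS.trans hT, ?_⟩
        rw [if_neg hp]
        rw [abs_le] at hS' hT' ⊢
        push_cast
        constructor <;> linarith
  have key' : ∀ (p : ℕ → Prop) [DecidablePred p],
      |∑ i ∈ Finset.range n, if p i then e i else 0| ≤ ε / 2 := by
    intro p _
    refine le_of_forall_pos_le_add fun ε' hε' => ?_
    obtain ⟨S, hS, hS'⟩ := key p (ε' / (n + 1)) (by positivity) n le_rfl
    have h₁ := H S (hn ▸ hS)
    have h₂ : n * (ε' / (n + 1)) ≤ ε' := by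
      rw [mul_div_assoc', div_le_iff₀ (by positivity)]; nlinarith
    rw [hn] at hS'
    rw [abs_lt] at h₁
    rw [abs_le] at hS' ⊢
    constructor <;> linarith
  classical
  have h₁ := key' fun i => 0 ≤ e i
  have h₂ := key' fun i => ¬ 0 ≤ e i
  have h₃ : ∑ i ∈ Finset.range n, |e i| =
      (∑ i ∈ Finset.range n, if 0 ≤ e i then e i else 0) -
        ∑ i ∈ Finset.range n, if ¬ 0 ≤ e i then e i else 0 := by
    rw [← Finset.sum_sub_distrib]
    refine Finset.sum_congr rfl fun i _ => ?_
    by_cases h : 0 ≤ e i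
    · simp [h, abs_of_nonneg h]
    · simp [h, abs_of_neg (not_le.1 h)]
  rw [h₃]
  rw [abs_le] at h₁ h₂
  linarith

end HasStratonovichIntegral

/-- The cubic variation of `w` vanishes, locally uniformly. -/
def VanishingCubicVariation (w : ℝ → ℝ) : Prop :=
  ∀ R : ℝ, ∀ ε > 0, ∃ η > 0, ∀ s t : ℝ, |s| ≤ R → |t| ≤ R → |t - s| < η →
    |w t - w s| ^ 3 ≤ ε * |t - s|

lemma abs_mul_cosh_sub_sinh_le {h : ℝ} (hh : |h| ≤ 1) :
    |(Real.exp h + Real.exp (-h)) / 2 * h - (Real.exp h - Real.exp (-h)) / 2| ≤ |h| ^ 3 := by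
  have e₁ := Real.exp_bound hh (n := 3) (by norm_num)
  have e₂ := Real.exp_bound (x := -h) (by simpa using hh) (n := 3) (by norm_num)
  simp only [Finset.sum_range_succ, Finset.sum_range_zero, Nat.factorial] at e₁ e₂
  norm_num at e₁ e₂
  set r := Real.exp h - (1 + h + h ^ 2 / 2) with hr
  set r' := Real.exp (-h) - (1 + -h + h ^ 2 / 2) with hr'
  have : (Real.exp h + Real.exp (-h)) / 2 * h - (Real.exp h - Real.exp (-h)) / 2 =
      (h ^ 3 + (h - 1) * r + (h + 1) * r') / 2 := by rw [hr, hr']; ring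
  rw [this, abs_div, abs_two]
  have b₁ : |(h - 1) * r| ≤ 2 * (|h| ^ 3 * (2 / 9)) := by
    rw [abs_mul]
    have : |h - 1| ≤ 2 := by rw [abs_le] at hh ⊢; constructor <;> linarith
    gcongr
  have b₂ : |(h + 1) * r'| ≤ 2 * (|h| ^ 3 * (2 / 9)) := by
    rw [abs_mul]
    have : |h + 1| ≤ 2 := by rw [abs_le] at hh ⊢; constructor <;> linarith
    gcongr
  have b₃ : |h ^ 3| = |h| ^ 3 := abs_pow h 3
  have := abs_add_three (h ^ 3) ((h - 1) * r) ((h + 1) * r')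
  have : 0 ≤ |h| ^ 3 := by positivity
  linarith

lemma abs_mean_exp_sub_le {α γ : ℝ} (h : |γ - α| ≤ 2) :
    |(Real.exp (-α) + Real.exp (-γ)) / 2 * ((γ - α) / 2) - (Real.exp (-α) - Real.exp (-γ)) / 2| ≤
      Real.exp (-(α + γ) / 2) * |γ - α| ^ 3 := by
  have h' : |(γ - α) / 2| ≤ 1 := by rw [abs_div, abs_two]; linarith
  have key := abs_mul_cosh_sub_sinh_le h'
  have e₁ : Real.exp (-α) = Real.exp (-(α + γ) / 2) * Real.exp ((γ - α) / 2) := by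
    rw [← Real.exp_add]; ring_nf
  have e₂ : Real.exp (-γ) = Real.exp (-(α + γ) / 2) * Real.exp (-((γ - α) / 2)) := by
    rw [← Real.exp_add]; ring_nf
  rw [e₁, e₂]
  have : ∀ p q r s : ℝ, (p * q + p * r) / 2 * s - (p * q - p * r) / 2 =
    p * ((q + r) / 2 * s - (q - r) / 2) := by intros; ring
  rw [this, abs_mul, Real.abs_exp]
  have : |(γ - α) / 2| ^ 3 ≤ |γ - α| ^ 3 := by
    rw [abs_div, abs_two]; gcongr; linarith [abs_nonneg (γ - α)]
  gcongr
  exact key.trans this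

/-- Comparison of the increments of `x * exp (-δ w)` with those of the Stratonovich equation
`dx = f dt + δ x ∘ dw`. -/
lemma exists_increment_comparison {x w f : ℝ → ℝ} {a b δ : ℝ}
    (hx : ContinuousOn x (Set.Icc a b)) (hf : ContinuousOn f (Set.Icc a b)) (hw : Continuous w)
    (hc : VanishingCubicVariation w) {ε : ℝ} (hε : 0 < ε) :
    ∃ η > 0, ∀ u v : ℝ, a ≤ u → u ≤ v → v ≤ b → v - u < η →
      |(x v * Real.exp (-(δ * w v)) - x u * Real.exp (-(δ * w u)) -
          ∫ s in u..v, Real.exp (-(δ * w s)) * f s) -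
        (Real.exp (-(δ * w u)) + Real.exp (-(δ * w v))) / 2 *
          (x v - x u - (∫ s in u..v, f s) - δ * trapezoid x w u v)| ≤ ε * (v - u) := by
  have hE : Continuous fun s => Real.exp (-(δ * w s)) := by fun_prop
  obtain ⟨A, hA⟩ := isCompact_Icc.exists_bound_of_continuousOn hx
  obtain ⟨M, hM⟩ := isCompact_Icc.exists_bound_of_continuousOn hf
  obtain ⟨B, hB⟩ := (isCompact_Icc (a := a) (b := b)).exists_bound_of_continuousOn hE.continuousOn
  set A' := |A| + 1
  set M' := |M| + 1
  set B' := |B| + 1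
  set D := |δ| + 1 with hD
  have hA' : 0 < A' := by positivity
  have hM' : 0 < M' := by positivity
  have hB' : 0 < B' := by positivity
  have hD' : 0 < D := by positivity
  set R := max |a| |b|
  obtain ⟨η₁, h₁, H₁⟩ := hc R (ε / 2 / (B' * D ^ 3 * (2 * A'))) (by positivity)
  obtain ⟨η₂, h₂, H₂⟩ := Metric.uniformContinuousOn_iff.1
    (isCompact_Icc.uniformContinuousOn_of_continuous (hE.continuousOn (s := Set.Icc a b)))
    (ε / 2 / M') (by positivity)
  obtain ⟨η₃, h₃, H₃⟩ := Metric.uniformContinuousOn_iff.1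
    (isCompact_Icc.uniformContinuousOn_of_continuous (hw.continuousOn (s := Set.Icc a b)))
    (2 / D) (by positivity)
  refine ⟨min η₁ (min η₂ η₃), by positivity, fun u v hau huv hvb hη => ?_⟩
  have g₁ : v - u < η₁ := hη.trans_le (min_le_left _ _)
  have g₂ : v - u < η₂ := hη.trans_le ((min_le_right _ _).trans (min_le_left _ _))
  have g₃ : v - u < η₃ := hη.trans_le ((min_le_right _ _).trans (min_le_right _ _))
  have hu : u ∈ Set.Icc a b := ⟨hau, huv.trans hvb⟩
  have hv : v ∈ Set.Icc a b := ⟨hau.trans huv, hvb⟩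
  have hR : ∀ t ∈ Set.Icc a b, |t| ≤ R := fun t ht => abs_le_max_abs_abs ht.1 ht.2
  have huvabs : |v - u| = v - u := abs_of_nonneg (by linarith)
  have hsub : Set.uIcc u v ⊆ Set.Icc a b := by
    rw [Set.uIcc_of_le huv]; exact Set.Icc_subset_Icc hau hvb
  have hfi : IntervalIntegrable f volume u v := (hf.mono hsub).intervalIntegrable
  have hEfi : IntervalIntegrable (fun s => Real.exp (-(δ * w s)) * f s) volume u v :=
    ((hE.continuousOn).mul (hf.mono hsub)).intervalIntegrable
  set p := Real.exp (-(δ * w u)) with hp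
  set q := Real.exp (-(δ * w v)) with hq
  have hid : (x v * q - x u * p - ∫ s in u..v, Real.exp (-(δ * w s)) * f s) -
        (p + q) / 2 * (x v - x u - (∫ s in u..v, f s) - δ * trapezoid x w u v) =
      (∫ s in u..v, ((p + q) / 2 - Real.exp (-(δ * w s))) * f s) +
      ((p + q) / 2 * ((δ * w v - δ * w u) / 2) - (p - q) / 2) * (x u + x v) := by
    have : ∫ s in u..v, ((p + q) / 2 - Real.exp (-(δ * w s))) * f s =
        (p + q) / 2 * (∫ s in u..v, f s) - ∫ s in u..v, Real.exp (-(δ * w s)) * f s := by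
      simp_rw [sub_mul]
      rw [intervalIntegral.integral_sub (hfi.const_mul _) hEfi,
        intervalIntegral.integral_const_mul]
    rw [this, trapezoid]
    ring
  rw [hid]
  have b₁ : |∫ s in u..v, ((p + q) / 2 - Real.exp (-(δ * w s))) * f s| ≤ ε / 2 * (v - u) := by
    have := intervalIntegral.norm_integral_le_of_norm_le_const (C := ε / 2) (a := u) (b := v)
      (f := fun s => ((p + q) / 2 - Real.exp (-(δ * w s))) * f s) (fun s hs => ?_)
    · rwa [huvabs] at this
    · rw [Set.uIoc_of_le huv] at hs
      have hs' : s ∈ Set.Icc a b := ⟨hau.trans hs.1.le, hs.2.trans hvb⟩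
      rw [norm_mul]
      have c₁ := H₂ u hu s hs' (by
        rw [Real.dist_eq, abs_sub_comm, abs_of_nonneg (by linarith [hs.1])]; linarith [hs.2])
      have c₂ := H₂ v hv s hs' (by
        rw [Real.dist_eq, abs_of_nonneg (by linarith [hs.2])]; linarith [hs.1])
      rw [Real.dist_eq] at c₁ c₂
      have c₃ : ‖(p + q) / 2 - Real.exp (-(δ * w s))‖ ≤ ε / 2 / M' := by
        rw [Real.norm_eq_abs]
        rw [abs_lt] at c₁ c₂
        rw [abs_le]; constructor <;> linarith
      have c₄ : ‖f s‖ ≤ M' := (hM s hs').trans (by linarith [le_abs_self M])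
      calc _ ≤ ε / 2 / M' * M' := by gcongr
        _ = ε / 2 := by field_simp
  have b₂ : |((p + q) / 2 * ((δ * w v - δ * w u) / 2) - (p - q) / 2) * (x u + x v)| ≤
      ε / 2 * (v - u) := by
    have d₀ : |δ * w v - δ * w u| ≤ D * |w v - w u| := by
      rw [← mul_sub, abs_mul]; gcongr; linarith
    have d₁ : |δ * w v - δ * w u| ≤ 2 := by
      have := H₃ v hv u hu (by rwa [Real.dist_eq, huvabs])
      rw [Real.dist_eq, lt_div_iff₀ hD'] at this
      linarith
    have d₂ := abs_mean_exp_sub_le d₁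
    have d₃ : Real.exp (-(δ * w u + δ * w v) / 2) ≤ B' := by
      have e₁ : p ≤ B' := by
        have := hB u hu; rw [Real.norm_eq_abs, Real.abs_exp] at this
        linarith [le_abs_self B]
      have e₂ : q ≤ B' := by
        have := hB v hv; rw [Real.norm_eq_abs, Real.abs_exp] at this
        linarith [le_abs_self B]
      rcases le_total (δ * w u) (δ * w v) with h | h
      · exact (Real.exp_le_exp.2 (by linarith)).trans e₁
      · exact (Real.exp_le_exp.2 (by linarith)).trans e₂
    have d₄ : |x u + x v| ≤ 2 * A' := by
      have e₁ := hA u hu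
      have e₂ := hA v hv
      rw [Real.norm_eq_abs] at e₁ e₂
      linarith [abs_add_le (x u) (x v), le_abs_self A]
    have d₅ := H₁ u v (hR u hu) (hR v hv) (by rwa [huvabs])
    rw [huvabs] at d₅
    rw [abs_mul]
    calc _ ≤ B' * (D * |w v - w u|) ^ 3 * (2 * A') := by
          refine mul_le_mul (d₂.trans ?_) d₄ (abs_nonneg _) (by positivity)
          gcongr
      _ = B' * D ^ 3 * (2 * A') * |w v - w u| ^ 3 := by ring
      _ ≤ B' * D ^ 3 * (2 * A') * (ε / 2 / (B' * D ^ 3 * (2 * A')) * (v - u)) := by gcongr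
      _ = _ := by field_simp
  linarith [abs_add_le (∫ s in u..v, ((p + q) / 2 - Real.exp (-(δ * w s))) * f s)
    (((p + q) / 2 * ((δ * w v - δ * w u) / 2) - (p - q) / 2) * (x u + x v))]

lemma exists_uniform_partition {a b η : ℝ} (hab : a ≤ b) (hη : 0 < η) :
    ∃ (n : ℕ) (u : ℕ → ℝ), u 0 = a ∧ u n = b ∧
      (∀ i < n, u i ≤ u (i + 1) ∧ u (i + 1) - u i < η) ∧ (∀ i ≤ n, u i ∈ Set.Icc a b) := by
  obtain ⟨n, hn⟩ := exists_nat_gt ((b - a) / η)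
  have hn0 : (0 : ℝ) < n := lt_of_le_of_lt (by have := sub_nonneg.2 hab; positivity) hn
  rw [div_lt_iff₀ hη] at hn
  have hba := sub_nonneg.2 hab
  refine ⟨n, fun i => a + i * ((b - a) / n), by simp, by field_simp; ring, fun i _ => ?_,
    fun i hi => ⟨?_, ?_⟩⟩
  · have h : a + (i + 1 : ℕ) * ((b - a) / n) = a + i * ((b - a) / n) + (b - a) / n := by
      push_cast; ring
    simp only [h]
    have : 0 ≤ (b - a) / n := by positivity
    have : (b - a) / n < η := by rw [div_lt_iff₀ hn0]; linarith
    constructor <;> linarith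
  · have : 0 ≤ i * ((b - a) / n) := by positivity
    linarith
  · have : (i : ℝ) * ((b - a) / n) ≤ n * ((b - a) / n) := by gcongr
    rw [mul_div_cancel₀ _ hn0.ne'] at this
    linarith

/-- If `dx = f dt + δ x ∘ dw` then `x * exp (-δ w)` has derivative `exp (-δ w) * f`. -/
lemma mul_exp_eq_of_stratonovich {x w f I : ℝ → ℝ} {a b δ : ℝ} (hab : a ≤ b)
    (hx : ContinuousOn x (Set.Icc a b)) (hf : ContinuousOn f (Set.Icc a b)) (hw : Continuous w)
    (hc : VanishingCubicVariation w)
    (hI : ∀ t ∈ Set.Icc a b, HasStratonovichIntegral x w a t (I t))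
    (heq : ∀ t ∈ Set.Icc a b, x t = x a + (∫ s in a..t, f s) + δ * I t) :
    x b * Real.exp (-(δ * w b)) =
      x a * Real.exp (-(δ * w a)) + ∫ s in a..b, Real.exp (-(δ * w s)) * f s := by
  have hE : Continuous fun s => Real.exp (-(δ * w s)) := by fun_prop
  obtain ⟨B, hB⟩ := (isCompact_Icc (a := a) (b := b)).exists_bound_of_continuousOn hE.continuousOn
  have hEle : ∀ t ∈ Set.Icc a b, Real.exp (-(δ * w t)) ≤ |B| + 1 := fun t ht => by
    have := hB t ht
    rw [Real.norm_eq_abs, Real.abs_exp] at this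
    linarith [le_abs_self B]
  suffices h : ∀ ε > 0, |x b * Real.exp (-(δ * w b)) - x a * Real.exp (-(δ * w a)) -
      ∫ s in a..b, Real.exp (-(δ * w s)) * f s| ≤ ε by
    have := abs_nonpos_iff.1 (le_of_forall_pos_le_add fun ε hε => (h ε hε).trans_eq (zero_add ε).symm)
    linarith
  intro ε hε
  have hba := sub_nonneg.2 hab
  obtain ⟨η₁, h₁, H₁⟩ := exists_increment_comparison (δ := δ) hx hf hw hc
    (ε := ε / 2 / (b - a + 1)) (by positivity)
  obtain ⟨η₂, h₂, H₂⟩ := HasStratonovichIntegral.saks_henstock hab hI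
    (ε := ε / 2 / ((|B| + 1) * (|δ| + 1))) (by positivity)
  obtain ⟨n, u, h0, hn, hu, hmem⟩ := exists_uniform_partition hab (lt_min h₁ h₂)
  have S₂ := H₂ n u h0 hn fun i hi => ⟨(hu i hi).1, (hu i hi).2.trans_le (min_le_right _ _)⟩
  have hii : ∀ g : ℝ → ℝ, ContinuousOn g (Set.Icc a b) → ∀ s ∈ Set.Icc a b, ∀ t ∈ Set.Icc a b,
      IntervalIntegrable g volume s t := fun g hg s hs t ht =>
    (hg.mono (Set.uIcc_subset_Icc hs ht)).intervalIntegrable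
  have hEf : ContinuousOn (fun s => Real.exp (-(δ * w s)) * f s) (Set.Icc a b) :=
    hE.continuousOn.mul hf
  have hamem : a ∈ Set.Icc a b := ⟨le_rfl, hab⟩
  set G : ℝ → ℝ := fun t => x t * Real.exp (-(δ * w t)) -
    ∫ s in a..t, Real.exp (-(δ * w s)) * f s with hG
  have htel : x b * Real.exp (-(δ * w b)) - x a * Real.exp (-(δ * w a)) -
      (∫ s in a..b, Real.exp (-(δ * w s)) * f s) =
      ∑ i ∈ Finset.range n, (G (u (i + 1)) - G (u i)) := by
    rw [Finset.sum_range_sub (fun i => G (u i)), h0, hn]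
    simp only [hG, intervalIntegral.integral_same]
    ring
  rw [htel]
  have hterm : ∀ i ∈ Finset.range n, |G (u (i + 1)) - G (u i)| ≤
      ε / 2 / (b - a + 1) * (u (i + 1) - u i) + (|B| + 1) * (|δ| + 1) *
        |trapezoid x w (u i) (u (i + 1)) - (I (u (i + 1)) - I (u i))| := by
    intro i hi
    rw [Finset.mem_range] at hi
    have m₀ := hmem i hi.le
    have m₁ := hmem (i + 1) hi
    have K := H₁ (u i) (u (i + 1)) m₀.1 (hu i hi).1 m₁.2 ((hu i hi).2.trans_le (min_le_left _ _))
    have e₁ : x (u (i + 1)) - x (u i) - (∫ s in u i..u (i + 1), f s) -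
        δ * trapezoid x w (u i) (u (i + 1)) =
        -(δ * (trapezoid x w (u i) (u (i + 1)) - (I (u (i + 1)) - I (u i)))) := by
      rw [heq _ m₀, heq _ m₁, ← intervalIntegral.integral_interval_sub_left
        (hii f hf a hamem _ m₁) (hii f hf a hamem _ m₀)]
      ring
    have e₂ : G (u (i + 1)) - G (u i) = x (u (i + 1)) * Real.exp (-(δ * w (u (i + 1)))) -
        x (u i) * Real.exp (-(δ * w (u i))) -
          ∫ s in u i..u (i + 1), Real.exp (-(δ * w s)) * f s := by
      rw [← intervalIntegral.integral_interval_sub_left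
        (hii _ hEf a hamem _ m₁) (hii _ hEf a hamem _ m₀)]
      simp only [hG]
      ring
    rw [e₁, ← e₂] at K
    set r := trapezoid x w (u i) (u (i + 1)) - (I (u (i + 1)) - I (u i))
    set c := (Real.exp (-(δ * w (u i))) + Real.exp (-(δ * w (u (i + 1))))) / 2
    have hc0 : 0 < c := by positivity
    have hc1 : c ≤ |B| + 1 := by
      have := hEle _ m₀
      have := hEle _ m₁
      simp only [c]; linarith
    have hcr : |c * -(δ * r)| ≤ (|B| + 1) * (|δ| + 1) * |r| := by
      rw [abs_mul, abs_neg, abs_mul, abs_of_pos hc0, ← mul_assoc]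
      gcongr
      linarith
    have := abs_add_le (G (u (i + 1)) - G (u i) - c * -(δ * r)) (c * -(δ * r))
    rw [sub_add_cancel] at this
    linarith
  calc _ ≤ _ := Finset.abs_sum_le_sum_abs _ _
    _ ≤ _ := Finset.sum_le_sum hterm
    _ = ε / 2 / (b - a + 1) * (b - a) + (|B| + 1) * (|δ| + 1) * ∑ i ∈ Finset.range n,
        |trapezoid x w (u i) (u (i + 1)) - (I (u (i + 1)) - I (u i))| := by
      rw [Finset.sum_add_distrib, ← Finset.mul_sum, ← Finset.mul_sum, Finset.sum_range_sub u,
        h0, hn]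
    _ ≤ ε / 2 / (b - a + 1) * (b - a + 1) +
        (|B| + 1) * (|δ| + 1) * (ε / 2 / ((|B| + 1) * (|δ| + 1))) := by
      gcongr
      linarith
    _ = ε := by field_simp; ring

/-- If `x * exp (-δ w)` has derivative `exp (-δ w) * f` then `dx = f dt + δ x ∘ dw`. -/
lemma hasStratonovichIntegral_of_mul_exp_eq {x w f : ℝ → ℝ} {a b δ : ℝ} (hab : a ≤ b)
    (hδ : δ ≠ 0)
    (hx : ContinuousOn x (Set.Icc a b)) (hf : ContinuousOn f (Set.Icc a b)) (hw : Continuous w)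
    (hc : VanishingCubicVariation w)
    (heq : ∀ t ∈ Set.Icc a b, x t * Real.exp (-(δ * w t)) =
      x a * Real.exp (-(δ * w a)) + ∫ s in a..t, Real.exp (-(δ * w s)) * f s) :
    HasStratonovichIntegral x w a b ((x b - x a - ∫ s in a..b, f s) / δ) := by
  have hE : Continuous fun s => Real.exp (-(δ * w s)) := by fun_prop
  obtain ⟨c, hc0, hcle⟩ : ∃ c > 0, ∀ t ∈ Set.Icc a b, c ≤ Real.exp (-(δ * w t)) := by
    obtain ⟨t, -, ht⟩ := isCompact_Icc.exists_isMinOn (Set.nonempty_Icc.2 hab) hE.continuousOn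
    exact ⟨_, Real.exp_pos _, fun s hs => ht hs⟩
  intro ε hε
  have hba := sub_nonneg.2 hab
  have hδ' : 0 < |δ| := abs_pos.2 hδ
  obtain ⟨η, hη, H⟩ := exists_increment_comparison (δ := δ) hx hf hw hc
    (ε := c * (|δ| * (ε / (b - a + 1)))) (by positivity)
  refine ⟨η, hη, fun n u h0 hn hu => ?_⟩
  have hmem : ∀ i ≤ n, u i ∈ Set.Icc a b := fun i hi =>
    ⟨h0 ▸ le_of_forall_le_succ (fun i hi => (hu i hi).1) i hi 0 (Nat.zero_le _),
      hn ▸ le_of_forall_le_succ (fun i hi => (hu i hi).1) n le_rfl i hi⟩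
  have hii : ∀ g : ℝ → ℝ, ContinuousOn g (Set.Icc a b) → ∀ s ∈ Set.Icc a b, ∀ t ∈ Set.Icc a b,
      IntervalIntegrable g volume s t := fun g hg s hs t ht =>
    (hg.mono (Set.uIcc_subset_Icc hs ht)).intervalIntegrable
  have hEf : ContinuousOn (fun s => Real.exp (-(δ * w s)) * f s) (Set.Icc a b) :=
    hE.continuousOn.mul hf
  have hamem : a ∈ Set.Icc a b := ⟨le_rfl, hab⟩
  set G : ℝ → ℝ := fun t => (x t - ∫ s in a..t, f s) / δ with hG
  have htel : (∑ i ∈ Finset.range n, (x (u i) + x (u (i + 1))) / 2 * (w (u (i + 1)) - w (u i))) -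
      (x b - x a - ∫ s in a..b, f s) / δ =
      ∑ i ∈ Finset.range n, (trapezoid x w (u i) (u (i + 1)) - (G (u (i + 1)) - G (u i))) := by
    rw [Finset.sum_sub_distrib, Finset.sum_range_sub (fun i => G (u i)), h0, hn]
    simp only [hG, intervalIntegral.integral_same, trapezoid]
    ring
  rw [htel]
  have hterm : ∀ i ∈ Finset.range n,
      |trapezoid x w (u i) (u (i + 1)) - (G (u (i + 1)) - G (u i))| ≤
      ε / (b - a + 1) * (u (i + 1) - u i) := by
    intro i hi
    rw [Finset.mem_range] at hi
    have m₀ := hmem i hi.le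
    have m₁ := hmem (i + 1) hi
    have K := H (u i) (u (i + 1)) m₀.1 (hu i hi).1 m₁.2 (hu i hi).2
    have e₁ : x (u (i + 1)) - x (u i) - (∫ s in u i..u (i + 1), f s) -
        δ * trapezoid x w (u i) (u (i + 1)) =
        -(δ * (trapezoid x w (u i) (u (i + 1)) - (G (u (i + 1)) - G (u i)))) := by
      simp only [hG]
      rw [← intervalIntegral.integral_interval_sub_left
        (hii f hf a hamem _ m₁) (hii f hf a hamem _ m₀)]
      field_simp
      ring
    have e₂ : x (u (i + 1)) * Real.exp (-(δ * w (u (i + 1)))) -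
        x (u i) * Real.exp (-(δ * w (u i))) -
          (∫ s in u i..u (i + 1), Real.exp (-(δ * w s)) * f s) = 0 := by
      rw [heq _ m₀, heq _ m₁, ← intervalIntegral.integral_interval_sub_left
        (hii _ hEf a hamem _ m₁) (hii _ hEf a hamem _ m₀)]
      ring
    rw [e₁, e₂] at K
    set r := trapezoid x w (u i) (u (i + 1)) - (G (u (i + 1)) - G (u i))
    set k := (Real.exp (-(δ * w (u i))) + Real.exp (-(δ * w (u (i + 1))))) / 2
    have hk : c ≤ k := by
      have := hcle _ m₀
      have := hcle _ m₁
      simp only [k]; linarith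
    rw [zero_sub, mul_neg, neg_neg, abs_mul, abs_mul, abs_of_pos (hc0.trans_le hk)] at K
    have hu' := sub_nonneg.2 (hu i hi).1
    have : c * (|δ| * |r|) ≤ c * (|δ| * (ε / (b - a + 1) * (u (i + 1) - u i))) := by
      calc _ ≤ k * (|δ| * |r|) := by gcongr
        _ ≤ _ := K
        _ = _ := by ring
    exact le_of_mul_le_mul_left (le_of_mul_le_mul_left this hc0) hδ'
  calc _ ≤ _ := Finset.abs_sum_le_sum_abs _ _
    _ ≤ _ := Finset.sum_le_sum hterm
    _ = ε / (b - a + 1) * (b - a) := by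
      rw [← Finset.mul_sum, Finset.sum_range_sub u, h0, hn]
    _ < ε := by
      rw [div_mul_eq_mul_div, div_lt_iff₀ (by positivity)]
      nlinarith

/-- The exponential weight `exp (lam r + δ w(r))`. -/
noncomputable def expWeight (lam δ : ℝ) (w : ℝ → ℝ) (r : ℝ) : ℝ := Real.exp (lam * r + δ * w r)

lemma expWeight_pos (lam δ : ℝ) (w : ℝ → ℝ) (r : ℝ) : 0 < expWeight lam δ w r := Real.exp_pos _

lemma Continuous.expWeight {w : ℝ → ℝ} (hw : Continuous w) (lam δ : ℝ) :
    Continuous (expWeight lam δ w) := by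
  unfold _root_.expWeight; fun_prop

/-- The denominator of the explicit solution of the logistic equation. -/
noncomputable def logisticDenom (lam δ : ℝ) (β w : ℝ → ℝ) (a x₀ t : ℝ) : ℝ :=
  1 + x₀ * ((∫ s in a..t, expWeight lam δ w s * β s) / expWeight lam δ w a)

/-- The explicit solution of `dx = (lam x - β x²) dt + δ x ∘ dw`, `x a = x₀`. -/
noncomputable def logisticFlow (lam δ : ℝ) (β w : ℝ → ℝ) (a x₀ t : ℝ) : ℝ :=
  x₀ * (expWeight lam δ w t / expWeight lam δ w a) / logisticDenom lam δ β w a x₀ t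

lemma logisticDenom_pos_of_nonneg {lam δ : ℝ} {β w : ℝ → ℝ} (hβ : ∀ t, 0 ≤ β t) {a t x₀ : ℝ}
    (hat : a ≤ t) (hx : 0 ≤ x₀) : 0 < logisticDenom lam δ β w a x₀ t := by
  have : 0 ≤ ∫ s in a..t, expWeight lam δ w s * β s :=
    intervalIntegral.integral_nonneg hat fun s _ => mul_nonneg (expWeight_pos _ _ _ _).le (hβ s)
  have := (expWeight_pos lam δ w a)
  unfold logisticDenom
  positivity

lemma isStratonovichSolution_logisticFlow {lam δ : ℝ} (hδ : δ ≠ 0) {β : ℝ → ℝ}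
    (hβ : Continuous β) {ω : PathSpace} (hc : VanishingCubicVariation ω.1) {a b x₀ : ℝ}
    (hpos : ∀ t ∈ Set.Icc a b, 0 < logisticDenom lam δ β ω.1 a x₀ t) :
    IsStratonovichSolution lam δ β ω a b x₀ (logisticFlow lam δ β ω.1 a x₀) := by
  have hw : Continuous ω.1 := ω.1.continuous
  set w : ℝ → ℝ := ⇑ω.1
  have hW := hw.expWeight lam δ
  have hWa := expWeight_pos lam δ w a
  have hDer : ∀ t, HasDerivAt (logisticDenom lam δ β w a x₀)
      (x₀ * (expWeight lam δ w t * β t / expWeight lam δ w a)) t := fun t =>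
    (((intervalIntegral.integral_hasDerivAt_right ((hW.mul hβ).intervalIntegrable _ _)
      ((hW.mul hβ).stronglyMeasurableAtFilter _ _) (hW.mul hβ).continuousAt).div_const _).const_mul
        x₀).const_add 1
  have hcont : ContinuousOn (logisticFlow lam δ β w a x₀) (Set.Icc a b) :=
    (by fun_prop : Continuous fun t => x₀ * (expWeight lam δ w t / expWeight lam δ w a))
      |>.continuousOn.div (fun t _ => (hDer t).continuousAt.continuousWithinAt)
      fun t ht => (hpos t ht).ne'
  have hinit : logisticFlow lam δ β w a x₀ a = x₀ := by
    simp [logisticFlow, logisticDenom, hWa.ne']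
  set x := logisticFlow lam δ β w a x₀ with hx
  set f : ℝ → ℝ := fun s => lam * x s - β s * x s ^ 2 with hf
  have hfc : ContinuousOn f (Set.Icc a b) := by
    apply ContinuousOn.sub
    · exact continuousOn_const.mul hcont
    · exact hβ.continuousOn.mul (hcont.pow 2)
  have hxy : ∀ t, x t * Real.exp (-(δ * w t)) =
      x₀ * (Real.exp (lam * t) / expWeight lam δ w a) / logisticDenom lam δ β w a x₀ t := by
    intro t
    rw [hx, logisticFlow, expWeight, Real.exp_add, Real.exp_neg]
    have := (Real.exp_pos (δ * w t)).ne'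
    field_simp
  have heq : ∀ t ∈ Set.Icc a b, x t * Real.exp (-(δ * w t)) =
      x a * Real.exp (-(δ * w a)) + ∫ s in a..t, Real.exp (-(δ * w s)) * f s := by
    intro t ht
    have hsub : Set.uIcc a t ⊆ Set.Icc a b := by
      rw [Set.uIcc_of_le ht.1]; exact Set.Icc_subset_Icc_right ht.2
    rw [intervalIntegral.integral_eq_sub_of_hasDerivAt
      (f := fun t => x t * Real.exp (-(δ * w t))) ?_ ?_]
    · ring
    · intro s hs
      have hD := hpos s (hsub hs)
      rw [show (fun t => x t * Real.exp (-(δ * w t))) = _ from funext hxy]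
      have hn : HasDerivAt (fun t => x₀ * (Real.exp (lam * t) / expWeight lam δ w a))
          (x₀ * (Real.exp (lam * s) * lam / expWeight lam δ w a)) s := by
        have := ((hasDerivAt_id s).const_mul lam).exp
        simp only [id, mul_one] at this
        exact (this.div_const _).const_mul x₀
      refine (hn.div (hDer s) hD.ne').congr_deriv (Eq.symm ?_)
      have hxs : x s = x₀ * (expWeight lam δ w s / expWeight lam δ w a) /
        logisticDenom lam δ β w a x₀ s := rfl
      simp only [hf]
      rw [hxs]
      have e : Real.exp (lam * s) = Real.exp (-(δ * w s)) * expWeight lam δ w s := by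
        rw [expWeight, ← Real.exp_add]; ring_nf
      rw [e]
      field_simp
    · exact ((by fun_prop : Continuous fun s => Real.exp (-(δ * w s))).continuousOn.mul
        (hfc.mono hsub)).intervalIntegrable
  refine ⟨hcont, hinit, fun t ht => ⟨_, hasStratonovichIntegral_of_mul_exp_eq ht.1 hδ
    (hcont.mono (Set.Icc_subset_Icc_right ht.2)) (hfc.mono (Set.Icc_subset_Icc_right ht.2)) hw hc
    fun s hs => heq s ⟨hs.1, hs.2.trans ht.2⟩, ?_⟩⟩
  rw [hinit]
  rw [mul_div_cancel₀ _ hδ]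
  ring

lemma IsStratonovichSolution.eqOn {lam δ : ℝ} {β : ℝ → ℝ}
    (hβ : Continuous β) {ω : PathSpace} (hc : VanishingCubicVariation ω.1) {a b x₀ : ℝ}
    {x z : ℝ → ℝ} (hx : IsStratonovichSolution lam δ β ω a b x₀ x)
    (hz : IsStratonovichSolution lam δ β ω a b x₀ z) : Set.EqOn x z (Set.Icc a b) := by
  have hw : Continuous ω.1 := ω.1.continuous
  set w : ℝ → ℝ := ⇑ω.1 with hwdef
  have hE : Continuous fun s => Real.exp (-(δ * w s)) := by fun_prop
  have hfc : ∀ {x : ℝ → ℝ}, IsStratonovichSolution lam δ β ω a b x₀ x →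
      ContinuousOn (fun s => lam * x s - β s * x s ^ 2) (Set.Icc a b) := fun hx =>
    (continuousOn_const.mul hx.continuousOn).sub (hβ.continuousOn.mul (hx.continuousOn.pow 2))
  have key : ∀ {x : ℝ → ℝ}, IsStratonovichSolution lam δ β ω a b x₀ x → ∀ t ∈ Set.Icc a b,
      x t * Real.exp (-(δ * w t)) = x₀ * Real.exp (-(δ * w a)) +
        ∫ s in a..t, Real.exp (-(δ * w s)) * (lam * x s - β s * x s ^ 2) := by
    intro x hx t ht
    choose! I hI using hx.integral_eq
    have hsub : Set.Icc a t ⊆ Set.Icc a b := Set.Icc_subset_Icc_right ht.2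
    have := mul_exp_eq_of_stratonovich ht.1 (hx.continuousOn.mono hsub) ((hfc hx).mono hsub)
      hw hc (fun s hs => (hI s (hsub hs)).1) (fun s hs => by
        rw [hx.initial]; exact (hI s (hsub hs)).2)
    rwa [hx.initial] at this
  set q : ℝ → ℝ := fun s => lam - β s * (x s + z s) with hq
  have hqc : ContinuousOn q (Set.Icc a b) :=
    continuousOn_const.sub (hβ.continuousOn.mul (hx.continuousOn.add hz.continuousOn))
  obtain ⟨K, hK⟩ := isCompact_Icc.exists_bound_of_continuousOn hqc
  set y : ℝ → ℝ := fun t => (x t - z t) * Real.exp (-(δ * w t)) with hy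
  have hyc : ContinuousOn y (Set.Icc a b) :=
    (hx.continuousOn.sub hz.continuousOn).mul hE.continuousOn
  have hyi : ∀ t ∈ Set.Icc a b, y t = ∫ s in a..t, q s * y s := by
    intro t ht
    have hsub : Set.uIcc a t ⊆ Set.Icc a b := by
      rw [Set.uIcc_of_le ht.1]; exact Set.Icc_subset_Icc_right ht.2
    have e : y t = x t * Real.exp (-(δ * w t)) - z t * Real.exp (-(δ * w t)) := by
      simp only [hy]; ring
    have hi : ∀ {x : ℝ → ℝ}, IsStratonovichSolution lam δ β ω a b x₀ x → IntervalIntegrable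
        (fun s => Real.exp (-(δ * w s)) * (lam * x s - β s * x s ^ 2)) volume a t := fun hx =>
      (hE.continuousOn.mul ((hfc hx).mono hsub)).intervalIntegrable
    rw [e, key hx t ht, key hz t ht, add_sub_add_left_eq_sub,
      ← intervalIntegral.integral_sub (hi hx) (hi hz)]
    congr 1 with s
    simp only [hq, hy]
    ring
  have hzero := eq_zero_of_abs_deriv_le_mul_abs_self_of_eq_zero_right (f := y)
    (f' := fun s => q s * y s) (K := K) hyc (fun s hs => ?_) ?_ (fun s hs => ?_)
  · intro t ht
    have h := hzero t ht
    simp only [hy, mul_eq_zero, (Real.exp_pos _).ne', or_false] at h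
    linarith
  · have hd : HasDerivWithinAt (fun t => ∫ s in a..t, q s * y s) (q s * y s) (Set.Ici s) s := by
      have hnh : Set.Icc a b ∈ 𝓝[>] s :=
        mem_of_superset (Ioo_mem_nhdsGT hs.2) fun r hr => ⟨hs.1.trans hr.1.le, hr.2.le⟩
      have hcs : ContinuousOn (fun s => q s * y s) (Set.Icc a b) := hqc.mul hyc
      refine intervalIntegral.integral_hasDerivWithinAt_right (t := Set.Ioi s) ?_ ?_ ?_
      · refine (hcs.mono ?_).intervalIntegrable
        rw [Set.uIcc_of_le hs.1]; exact Set.Icc_subset_Icc_right hs.2.le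
      · exact ⟨_, hnh, hcs.aestronglyMeasurable measurableSet_Icc⟩
      · exact (hcs s ⟨hs.1, hs.2.le⟩).mono_of_mem_nhdsWithin hnh
    refine hd.congr_of_eventuallyEq ?_ (hyi s ⟨hs.1, hs.2.le⟩)
    filter_upwards [Ico_mem_nhdsGE hs.2] with t ht
    exact hyi t ⟨hs.1.trans ht.1, ht.2.le⟩
  · simp [hy, hx.initial, hz.initial]
  · rw [norm_mul]
    exact mul_le_mul_of_nonneg_right (hK s ⟨hs.1, hs.2.le⟩) (norm_nonneg _)

lemma solution_eq_logisticFlow {lam δ : ℝ} (hδ : δ ≠ 0) {β : ℝ → ℝ}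
    (hβ : Continuous β) {ω : PathSpace} (hc : VanishingCubicVariation ω.1) {a b x₀ : ℝ}
    (hab : a ≤ b) (hpos : ∀ t ∈ Set.Icc a b, 0 < logisticDenom lam δ β ω.1 a x₀ t) :
    solution lam δ β b a ω x₀ = logisticFlow lam δ β ω.1 a x₀ b := by
  have hs := isStratonovichSolution_logisticFlow hδ hβ hc hpos
  have h : SolutionExists lam δ β ω a b x₀ := ⟨_, hs⟩
  rw [solution, dif_pos h]
  exact h.choose_spec.eqOn hβ hc hs ⟨hab, le_rfl⟩

/-- `w` grows sublinearly at `±∞`. -/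
def SublinearGrowth (w : ℝ → ℝ) : Prop := ∀ ε > 0, ∃ C : ℝ, ∀ t, |w t| ≤ C + ε * |t|

lemma SublinearGrowth.exists_abs_mul_le {w : ℝ → ℝ} (h : SublinearGrowth w) (δ : ℝ) {κ : ℝ}
    (hκ : 0 < κ) : ∃ C : ℝ, ∀ t, |δ * w t| ≤ C + κ * |t| := by
  obtain ⟨C, hC⟩ := h (κ / (|δ| + 1)) (by positivity)
  refine ⟨|δ| * C, fun t => ?_⟩
  rw [abs_mul]
  calc |δ| * |w t| ≤ |δ| * (C + κ / (|δ| + 1) * |t|) := by gcongr; exact hC t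
    _ = |δ| * C + |δ| / (|δ| + 1) * (κ * |t|) := by ring
    _ ≤ |δ| * C + 1 * (κ * |t|) := by
      gcongr
      rw [div_le_one (by positivity)]; linarith
    _ = _ := by ring

section Weight

variable {lam δ : ℝ} {w β : ℝ → ℝ} {β₀ β₁ : ℝ}

lemma integrableOn_expWeight_mul_Iic (hw : Continuous w) (hs : SublinearGrowth w)
    (hlam : 0 < lam) (hβ : Continuous β) (hβ₁ : ∀ t, |β t| ≤ β₁) (c : ℝ) :
    IntegrableOn (fun r => expWeight lam δ w r * β r) (Set.Iic c) := by
  obtain ⟨C, hC⟩ := hs.exists_abs_mul_le δ (half_pos hlam)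
  refine Integrable.mono' (g := fun r => Real.exp (C + lam * |c|) * β₁ * Real.exp (lam / 2 * r))
    ((integrableOn_exp_mul_Iic (half_pos hlam) c).const_mul _)
    ((hw.expWeight lam δ).mul hβ).aestronglyMeasurable ?_
  filter_upwards [ae_restrict_mem measurableSet_Iic] with r hr
  have hr : r ≤ c := hr
  rw [norm_mul, Real.norm_eq_abs, Real.norm_eq_abs, abs_of_pos (expWeight_pos _ _ _ _)]
  have h1 : |r| ≤ 2 * |c| - r := by
    rcases le_total 0 r with h | h
    · rw [abs_of_nonneg h]; linarith [le_abs_self c]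
    · rw [abs_of_nonpos h]; linarith [abs_nonneg c]
  have h2 : expWeight lam δ w r ≤ Real.exp (C + lam * |c|) * Real.exp (lam / 2 * r) := by
    rw [expWeight, ← Real.exp_add, Real.exp_le_exp]
    have := hC r
    have := le_abs_self (δ * w r)
    nlinarith
  calc _ ≤ Real.exp (C + lam * |c|) * Real.exp (lam / 2 * r) * β₁ :=
        mul_le_mul h2 (hβ₁ r) (abs_nonneg _) (by positivity)
    _ = _ := by ring

lemma expWeight_comp_neg (lam δ : ℝ) (w : ℝ → ℝ) (r : ℝ) :
    expWeight (-lam) δ (fun s => w (-s)) r = expWeight lam δ w (-r) := by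
  simp [expWeight]

lemma SublinearGrowth.comp_neg (h : SublinearGrowth w) : SublinearGrowth fun t => w (-t) := by
  intro ε hε
  obtain ⟨C, hC⟩ := h ε hε
  exact ⟨C, fun t => by simpa using hC (-t)⟩

lemma integrableOn_expWeight_mul_Ioi (hw : Continuous w) (hs : SublinearGrowth w)
    (hlam : lam < 0) (hβ : Continuous β) (hβ₁ : ∀ t, |β t| ≤ β₁) (c : ℝ) :
    IntegrableOn (fun r => expWeight lam δ w r * β r) (Set.Ioi c) := by
  have h := integrableOn_expWeight_mul_Iic (w := fun t => w (-t)) (lam := -lam) (δ := δ)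
    (β := fun t => β (-t)) (by fun_prop) hs.comp_neg (by linarith) (by fun_prop)
    (fun t => hβ₁ (-t)) (-c)
  simp_rw [expWeight_comp_neg] at h
  have := h.comp_neg
  simp only [neg_neg] at this
  rw [Set.neg_Iic, neg_neg] at this
  exact this.mono_set Set.Ioi_subset_Ici_self

lemma integral_expWeight_mul_Iic_pos (hβ : ∀ t, 0 < β t) {c : ℝ}
    (hi : IntegrableOn (fun r => expWeight lam δ w r * β r) (Set.Iic c)) :
    0 < ∫ r in Set.Iic c, expWeight lam δ w r * β r := by
  have hp : ∀ r, 0 < expWeight lam δ w r * β r := fun r => mul_pos (expWeight_pos _ _ _ _) (hβ r)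
  rw [setIntegral_pos_iff_support_of_nonneg_ae (ae_of_all _ fun r => (hp r).le) hi]
  have : Function.support (fun r => expWeight lam δ w r * β r) = Set.univ := by
    ext r; simpa using (hp r).ne'
  rw [this]; simp

lemma integral_expWeight_mul_Ioi_pos (hβ : ∀ t, 0 < β t) {c : ℝ}
    (hi : IntegrableOn (fun r => expWeight lam δ w r * β r) (Set.Ioi c)) :
    0 < ∫ r in Set.Ioi c, expWeight lam δ w r * β r := by
  have hp : ∀ r, 0 < expWeight lam δ w r * β r := fun r => mul_pos (expWeight_pos _ _ _ _) (hβ r)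
  rw [setIntegral_pos_iff_support_of_nonneg_ae (ae_of_all _ fun r => (hp r).le) hi]
  have : Function.support (fun r => expWeight lam δ w r * β r) = Set.univ := by
    ext r; simpa using (hp r).ne'
  rw [this]; simp

lemma tendsto_integral_expWeight_mul_Iic_atTop (hw : Continuous w) (hs : SublinearGrowth w)
    (hn : ¬ IntegrableOn (fun r => Real.exp (δ * w r)) (Set.Iic 0))
    (hβ : Continuous β) (hβ₀ : 0 < β₀) (hb : ∀ t, β₀ ≤ β t ∧ β t ≤ β₁) :
    Tendsto (fun lam => ∫ r in Set.Iic 0, expWeight lam δ w r * β r) (𝓝[>] 0) atTop := by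
  have hE : Continuous fun r => Real.exp (δ * w r) := by fun_prop
  have hbig : ∀ M : ℝ, ∃ R > 0, M < ∫ r in (-R)..0, Real.exp (δ * w r) := by
    intro M
    by_contra! hcon
    refine hn (integrableOn_Iic_of_intervalIntegral_norm_bounded M 0
      (a := fun R : ℝ => -R) (l := atTop) (fun R => ?_) tendsto_neg_atTop_atBot ?_)
    · exact (hE.integrableOn_Icc).mono_set Set.Ioc_subset_Icc_self
    · filter_upwards [eventually_gt_atTop 0] with R hR
      simpa using hcon R hR
  rw [tendsto_atTop]
  intro M
  obtain ⟨R, hR, hM⟩ := hbig (max M 0 * 2 / β₀)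
  have hev : Set.Ioo 0 (1 / (2 * R)) ∈ 𝓝[>] (0 : ℝ) := Ioo_mem_nhdsGT (by positivity)
  filter_upwards [hev] with lam hlam
  have hlam0 := hlam.1
  have hi : IntegrableOn (fun r => expWeight lam δ w r * β r) (Set.Iic 0) :=
    integrableOn_expWeight_mul_Iic hw hs hlam0 hβ (β₁ := β₁)
      (fun t => abs_le.2 ⟨by linarith [hb t], (hb t).2⟩) 0
  have h1 : ∫ r in (-R)..0, expWeight lam δ w r * β r ≤
      ∫ r in Set.Iic 0, expWeight lam δ w r * β r := by
    rw [intervalIntegral.integral_of_le (by linarith)]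
    refine setIntegral_mono_set hi (ae_of_all _ fun r => ?_)
      (Set.Ioc_subset_Iic_self).eventuallyLE
    exact mul_nonneg (expWeight_pos _ _ _ _).le (hβ₀.le.trans (hb r).1)
  have h2 : ∫ r in (-R)..0, Real.exp (δ * w r) * (β₀ / 2) ≤
      ∫ r in (-R)..0, expWeight lam δ w r * β r := by
    refine intervalIntegral.integral_mono_on (by linarith)
      ((hE.mul continuous_const).intervalIntegrable _ _)
      (((hw.expWeight lam δ).mul hβ).intervalIntegrable _ _) fun r hr => ?_
    have e1 : 1 / 2 ≤ Real.exp (lam * r) := by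
      have h3 := hlam.2
      rw [lt_div_iff₀ (by positivity)] at h3
      have := Real.add_one_le_exp (lam * r)
      nlinarith [hr.1, hr.2]
    rw [expWeight, Real.exp_add]
    have := (hb r).1
    calc Real.exp (δ * w r) * (β₀ / 2) = 1 / 2 * Real.exp (δ * w r) * β₀ := by ring
      _ ≤ _ := by gcongr
  rw [intervalIntegral.integral_mul_const] at h2
  have h4 : max M 0 ≤ (∫ r in (-R)..0, Real.exp (δ * w r)) * (β₀ / 2) := by
    rw [div_lt_iff₀ hβ₀] at hM
    linarith
  linarith [le_max_left M 0]

lemma tendsto_integral_expWeight_mul_Ioi_atTop (hw : Continuous w) (hs : SublinearGrowth w)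
    (hn : ¬ IntegrableOn (fun r => Real.exp (δ * w r)) (Set.Ioi 0))
    (hβ : Continuous β) (hβ₀ : 0 < β₀) (hb : ∀ t, β₀ ≤ β t ∧ β t ≤ β₁) :
    Tendsto (fun lam => ∫ r in Set.Ioi 0, expWeight lam δ w r * β r) (𝓝[<] 0) atTop := by
  have h := tendsto_integral_expWeight_mul_Iic_atTop (w := fun t => w (-t)) (δ := δ)
    (β := fun t => β (-t)) (β₀ := β₀) (β₁ := β₁) (by fun_prop) hs.comp_neg (fun hi => hn ?_)
    (by fun_prop) hβ₀ (fun t => hb (-t))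
  · have hneg : Tendsto (fun x : ℝ => -x) (𝓝[<] 0) (𝓝[>] 0) := by
      simpa using tendsto_neg_nhdsLT (a := (0 : ℝ))
    refine (h.comp hneg).congr fun lam => ?_
    simp only [Function.comp_apply, expWeight_comp_neg]
    rw [integral_comp_neg_Iic 0 fun r => expWeight lam δ w r * β r, neg_zero]
  · have := hi.comp_neg
    simp only [neg_neg] at this
    rw [Set.neg_Iic, neg_zero] at this
    exact this.mono_set Set.Ioi_subset_Ici_self

end Weight

/-- The paths along which the bifurcation takes place. -/
structure IsRegularPath (δ : ℝ) (w : ℝ → ℝ) : Prop where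
  cubic : VanishingCubicVariation w
  growth : SublinearGrowth w
  not_integrableOn_Ioi : ¬ IntegrableOn (fun r => Real.exp (δ * w r)) (Set.Ioi 0)
  not_integrableOn_Iic : ¬ IntegrableOn (fun r => Real.exp (δ * w r)) (Set.Iic 0)

lemma wienerShift_apply (t : ℝ) (ω : PathSpace) (s : ℝ) :
    (wienerShift t ω).1 s = ω.1 (s + t) - ω.1 t := rfl

lemma wienerShift_wienerShift (s t : ℝ) (ω : PathSpace) :
    wienerShift s (wienerShift t ω) = wienerShift (s + t) ω := by
  apply Subtype.ext
  ext r
  simp only [wienerShift_apply]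
  rw [add_assoc, sub_sub_sub_cancel_right]

lemma wienerShift_zero (ω : PathSpace) : wienerShift 0 ω = ω := by
  apply Subtype.ext
  ext r
  simp [wienerShift_apply, ω.2]

lemma IsRegularPath.wienerShift {δ : ℝ} {ω : PathSpace} (h : IsRegularPath δ ω.1) (t : ℝ) :
    IsRegularPath δ (wienerShift t ω).1 := by
  have hE : Continuous fun r => Real.exp (δ * ω.1 r) := by fun_prop
  have hE' : Continuous fun r => Real.exp (δ * (_root_.wienerShift t ω).1 r) := by fun_prop
  have hshift : ∀ r, Real.exp (δ * ω.1 r) =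
      Real.exp (δ * ω.1 t) * Real.exp (δ * (_root_.wienerShift t ω).1 (r - t)) := by
    intro r
    rw [← Real.exp_add, wienerShift_apply, sub_add_cancel]
    ring_nf
  refine ⟨fun R ε hε => ?_, fun ε hε => ?_, fun hi => h.not_integrableOn_Ioi ?_,
    fun hi => h.not_integrableOn_Iic ?_⟩
  · obtain ⟨η, hη, H⟩ := h.cubic (R + |t|) ε hε
    refine ⟨η, hη, fun r s hr hs hrs => ?_⟩
    have := H (r + t) (s + t) ((abs_add_le _ _).trans (by linarith))
      ((abs_add_le _ _).trans (by linarith)) (by rwa [add_sub_add_right_eq_sub])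
    rw [add_sub_add_right_eq_sub] at this
    rwa [wienerShift_apply, wienerShift_apply, sub_sub_sub_cancel_right]
  · obtain ⟨C, hC⟩ := h.growth ε hε
    refine ⟨C + ε * |t| + |ω.1 t|, fun s => ?_⟩
    rw [wienerShift_apply]
    have h1 := abs_sub (ω.1 (s + t)) (ω.1 t)
    have h2 := hC (s + t)
    have h3 := mul_le_mul_of_nonneg_left (abs_add_le s t) hε.le
    linarith
  · have h1 : IntegrableOn (fun r => Real.exp (δ * (_root_.wienerShift t ω).1 (r - t)))
        (Set.Ioi t) := by
      have := (measurePreserving_sub_right volume t).integrableOn_comp_preimage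
        (measurableEmbedding_subRight t) (s := Set.Ioi 0)
        (f := fun r => Real.exp (δ * (_root_.wienerShift t ω).1 r))
      have e := this.2 hi
      rw [Set.preimage_sub_const_Ioi, zero_add] at e
      exact e
    have h2 : IntegrableOn (fun r => Real.exp (δ * ω.1 r)) (Set.Ioi t) := by
      rw [show (fun r => Real.exp (δ * ω.1 r)) = _ from funext hshift]
      exact h1.const_mul _
    have h3 := h2.union (hE.integrableOn_Icc (a := 0) (b := t))
    refine h3.mono_set fun r hr => ?_
    by_cases hrt : t < r
    · exact Or.inl hrt
    · exact Or.inr ⟨le_of_lt hr, not_lt.1 hrt⟩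
  · have h1 : IntegrableOn (fun r => Real.exp (δ * (_root_.wienerShift t ω).1 (r - t)))
        (Set.Iic t) := by
      have := (measurePreserving_sub_right volume t).integrableOn_comp_preimage
        (measurableEmbedding_subRight t) (s := Set.Iic 0)
        (f := fun r => Real.exp (δ * (_root_.wienerShift t ω).1 r))
      have e := this.2 hi
      rw [Set.preimage_sub_const_Iic, zero_add] at e
      exact e
    have h2 : IntegrableOn (fun r => Real.exp (δ * ω.1 r)) (Set.Iic t) := by
      rw [show (fun r => Real.exp (δ * ω.1 r)) = _ from funext hshift]
      exact h1.const_mul _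
    have h3 := h2.union (hE.integrableOn_Icc (a := t) (b := 0))
    refine h3.mono_set fun r hr => ?_
    by_cases hrt : r ≤ t
    · exact Or.inl hrt
    · exact Or.inr ⟨(not_le.1 hrt).le, hr⟩

lemma preimage_wienerShift_isRegularPath (δ t : ℝ) :
    wienerShift t ⁻¹' {ω | IsRegularPath δ ω.1} = {ω | IsRegularPath δ ω.1} := by
  ext ω
  refine ⟨fun h => ?_, fun h => IsRegularPath.wienerShift h t⟩
  have := IsRegularPath.wienerShift h (-t)
  rwa [wienerShift_wienerShift, neg_add_cancel, wienerShift_zero] at this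

lemma expWeight_wienerShift (lam δ s : ℝ) (ω : PathSpace) (r : ℝ) :
    expWeight lam δ (wienerShift s ω).1 r =
      expWeight lam δ ω.1 (r + s) / expWeight lam δ ω.1 s := by
  rw [expWeight, expWeight, expWeight, ← Real.exp_sub, wienerShift_apply]
  ring_nf

lemma expWeight_pathSpace_zero (lam δ : ℝ) (ω : PathSpace) : expWeight lam δ ω.1 0 = 1 := by
  simp [expWeight, ω.2]

lemma logisticDenom_wienerShift (lam δ τ : ℝ) (β : ℝ → ℝ) (ω : PathSpace) (a x₀ t : ℝ) :
    logisticDenom lam δ β (wienerShift (-τ) ω).1 a x₀ t =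
      logisticDenom lam δ (fun r => β (r + τ)) ω.1 (a - τ) x₀ (t - τ) := by
  have h0 := (expWeight_pos lam δ ω.1 (-τ)).ne'
  have h1 := (expWeight_pos lam δ ω.1 (a - τ)).ne'
  have key : ∫ s in a..t, expWeight lam δ (wienerShift (-τ) ω).1 s * β s =
      (∫ s in (a - τ)..(t - τ), expWeight lam δ ω.1 s * β (s + τ)) /
        expWeight lam δ ω.1 (-τ) := by
    rw [← intervalIntegral.integral_comp_sub_right
      (fun s => expWeight lam δ ω.1 s * β (s + τ)) τ, ← intervalIntegral.integral_div]
    congr 1 with s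
    rw [expWeight_wienerShift, sub_add_cancel, ← sub_eq_add_neg]
    ring
  rw [logisticDenom, logisticDenom, key, expWeight_wienerShift, ← sub_eq_add_neg]
  field_simp

lemma logisticFlow_wienerShift (lam δ τ : ℝ) (β : ℝ → ℝ) (ω : PathSpace) (a x₀ t : ℝ) :
    logisticFlow lam δ β (wienerShift (-τ) ω).1 a x₀ t =
      logisticFlow lam δ (fun r => β (r + τ)) ω.1 (a - τ) x₀ (t - τ) := by
  have h0 := (expWeight_pos lam δ ω.1 (-τ)).ne'
  have h1 := (expWeight_pos lam δ ω.1 (a - τ)).ne'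
  rw [logisticFlow, logisticFlow, logisticDenom_wienerShift, expWeight_wienerShift,
    expWeight_wienerShift, ← sub_eq_add_neg, ← sub_eq_add_neg]
  congr 2
  field_simp

section Cocycle

variable {lam δ : ℝ} {β : ℝ → ℝ} {ω : PathSpace}

lemma cocycle_spec (hδ : δ ≠ 0) (hβ : Continuous β) (h : IsRegularPath δ ω.1) {t τ x₀ : ℝ}
    (ht : 0 ≤ t)
    (hpos : ∀ s ∈ Set.Icc 0 t, 0 < 1 + x₀ * ∫ r in 0..s, expWeight lam δ ω.1 r * β (r + τ)) :
    SolutionExists lam δ β (wienerShift (-τ) ω) τ (t + τ) x₀ ∧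
    solutionCocycle lam δ β t τ ω x₀ =
      x₀ * expWeight lam δ ω.1 t / (1 + x₀ * ∫ r in 0..t, expWeight lam δ ω.1 r * β (r + τ)) := by
  have hden : ∀ s ∈ Set.Icc τ (t + τ),
      0 < logisticDenom lam δ β (wienerShift (-τ) ω).1 τ x₀ s := by
    intro s hs
    rw [logisticDenom_wienerShift, logisticDenom, sub_self, expWeight_pathSpace_zero, div_one]
    exact hpos _ ⟨by linarith [hs.1], by linarith [hs.2]⟩
  have hc := (h.wienerShift (-τ)).cubic
  refine ⟨⟨_, isStratonovichSolution_logisticFlow hδ hβ hc hden⟩, ?_⟩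
  rw [solutionCocycle, solution_eq_logisticFlow hδ hβ hc (by linarith) hden,
    logisticFlow_wienerShift, logisticFlow, logisticDenom, sub_self, expWeight_pathSpace_zero,
    div_one, div_one, add_sub_cancel_right]

lemma cocycle_zero (hδ : δ ≠ 0) (hβ : Continuous β) (h : IsRegularPath δ ω.1) {t τ : ℝ}
    (ht : 0 ≤ t) :
    SolutionExists lam δ β (wienerShift (-τ) ω) τ (t + τ) 0 ∧
      solutionCocycle lam δ β t τ ω 0 = 0 := by
  obtain ⟨h1, h2⟩ := cocycle_spec (lam := lam) (τ := τ) (x₀ := 0) hδ hβ h ht (by simp)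
  exact ⟨h1, by simpa using h2⟩

lemma cocycle_pullback (hδ : δ ≠ 0) (hβ : Continuous β) (hβ0 : ∀ t, 0 ≤ β t)
    (h : IsRegularPath δ ω.1) {t τ x₀ : ℝ} (ht : 0 ≤ t) (hx : 0 ≤ x₀) :
    solutionCocycle lam δ β t (τ - t) (wienerShift (-t) ω) x₀ =
      x₀ / (expWeight lam δ ω.1 (-t) +
        x₀ * ∫ r in (-t)..0, expWeight lam δ ω.1 r * β (r + τ)) := by
  have hE := expWeight_pos lam δ ω.1 (-t)
  rw [(cocycle_spec hδ hβ (h.wienerShift (-t)) ht fun s hs => ?_).2]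
  · have key : ∫ r in 0..t, expWeight lam δ (wienerShift (-t) ω).1 r * β (r + (τ - t)) =
        (∫ r in (-t)..0, expWeight lam δ ω.1 r * β (r + τ)) / expWeight lam δ ω.1 (-t) := by
      have := intervalIntegral.integral_comp_sub_right (a := 0) (b := t)
        (fun s => expWeight lam δ ω.1 s * β (s + τ)) t
      rw [zero_sub, sub_self] at this
      rw [← this, ← intervalIntegral.integral_div]
      congr 1 with s
      rw [expWeight_wienerShift, ← sub_eq_add_neg, add_sub, sub_add_eq_add_sub]
      ring
    rw [key, expWeight_wienerShift, add_neg_cancel, expWeight_pathSpace_zero]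
    have hI : 0 ≤ ∫ r in (-t)..0, expWeight lam δ ω.1 r * β (r + τ) :=
      intervalIntegral.integral_nonneg (by linarith) fun s _ =>
        mul_nonneg (expWeight_pos _ _ _ _).le (hβ0 _)
    have : 0 < expWeight lam δ ω.1 (-t) +
        x₀ * ∫ r in (-t)..0, expWeight lam δ ω.1 r * β (r + τ) := by positivity
    field_simp
  · have : 0 ≤ ∫ r in 0..s, expWeight lam δ (wienerShift (-t) ω).1 r * β (r + (τ - t)) :=
      intervalIntegral.integral_nonneg hs.1 fun s _ =>
        mul_nonneg (expWeight_pos _ _ _ _).le (hβ0 _)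
    positivity

end Cocycle

section Bifurcating

variable {lam δ : ℝ} {β : ℝ → ℝ}

lemma bifurcatingSolution_of_pos (h : 0 < lam) (τ : ℝ) (ω : PathSpace) :
    bifurcatingSolution lam δ β τ ω =
      (∫ r in Set.Iic 0, expWeight lam δ ω.1 r * β (r + τ))⁻¹ := if_pos h

lemma bifurcatingSolution_of_neg (h : lam < 0) (τ : ℝ) (ω : PathSpace) :
    bifurcatingSolution lam δ β τ ω =
      -(∫ r in Set.Ioi 0, expWeight lam δ ω.1 r * β (r + τ))⁻¹ := by
  rw [bifurcatingSolution, if_neg h.not_gt, if_pos h]; rfl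

lemma measurable_bifurcatingSolution (hβ : Continuous β) (τ : ℝ) :
    Measurable (bifurcatingSolution lam δ β τ) := by
  have hm : ∀ s : Set ℝ, Measurable fun ω : PathSpace =>
      ∫ r in s, expWeight lam δ ω.1 r * β (r + τ) := by
    intro s
    have hu : Measurable (Function.uncurry fun (r : ℝ) (ω : PathSpace) =>
        expWeight lam δ ω.1 r * β (r + τ)) := by
      refine measurable_uncurry_of_continuous_of_measurable (fun ω => ?_) fun r => ?_
      · exact (ω.1.continuous.expWeight lam δ).mul (by fun_prop)
      · have : Continuous fun ω : PathSpace => ω.1 r :=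
          (ContinuousEvalConst.continuous_eval_const r).comp continuous_subtype_val
        exact (by unfold expWeight; fun_prop : Continuous fun ω : PathSpace =>
          expWeight lam δ ω.1 r * β (r + τ)).measurable
    exact (hu.stronglyMeasurable.integral_prod_left' (μ := volume.restrict s)).measurable
  rcases lt_trichotomy lam 0 with h | h | h
  · rw [show bifurcatingSolution lam δ β τ = _ from funext (bifurcatingSolution_of_neg h τ)]
    exact (hm _).inv.neg
  · subst h
    rw [show bifurcatingSolution 0 δ β τ = fun _ => 0 from funext fun ω => by
      simp [bifurcatingSolution]]
    exact measurable_const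
  · rw [show bifurcatingSolution lam δ β τ = _ from funext (bifurcatingSolution_of_pos h τ)]
    exact (hm _).inv

variable {β₀ β₁ : ℝ} {ω : PathSpace}

lemma integral_Iic_comp_add_right (g : ℝ → ℝ) (t : ℝ) :
    ∫ r in Set.Iic 0, g (r + t) = ∫ r in Set.Iic t, g r := by
  have := (measurePreserving_add_right volume t).setIntegral_preimage_emb
    (measurableEmbedding_addRight t) g (Set.Iic t)
  rwa [Set.preimage_add_const_Iic, sub_self] at this

lemma integral_Ioi_comp_add_right (g : ℝ → ℝ) (t : ℝ) :
    ∫ r in Set.Ioi 0, g (r + t) = ∫ r in Set.Ioi t, g r := by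
  have := (measurePreserving_add_right volume t).setIntegral_preimage_emb
    (measurableEmbedding_addRight t) g (Set.Ioi t)
  rwa [Set.preimage_add_const_Ioi, sub_self] at this

lemma bifurcatingSolution_wienerShift_of_pos (h : 0 < lam) (τ t : ℝ) :
    bifurcatingSolution lam δ β (τ + t) (wienerShift t ω) =
      expWeight lam δ ω.1 t * (∫ r in Set.Iic t, expWeight lam δ ω.1 r * β (r + τ))⁻¹ := by
  rw [bifurcatingSolution_of_pos h,
    ← integral_Iic_comp_add_right (fun r => expWeight lam δ ω.1 r * β (r + τ)) t]
  have : ∀ r, expWeight lam δ (wienerShift t ω).1 r * β (r + (τ + t)) =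
      expWeight lam δ ω.1 (r + t) * β (r + t + τ) / expWeight lam δ ω.1 t := by
    intro r
    rw [expWeight_wienerShift, show r + (τ + t) = r + t + τ by ring]; ring
  simp_rw [this]
  rw [integral_div, inv_div, div_eq_mul_inv]

lemma bifurcatingSolution_wienerShift_of_neg (h : lam < 0) (τ t : ℝ) :
    bifurcatingSolution lam δ β (τ + t) (wienerShift t ω) =
      -(expWeight lam δ ω.1 t * (∫ r in Set.Ioi t, expWeight lam δ ω.1 r * β (r + τ))⁻¹) := by
  rw [bifurcatingSolution_of_neg h,
    ← integral_Ioi_comp_add_right (fun r => expWeight lam δ ω.1 r * β (r + τ)) t]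
  have : ∀ r, expWeight lam δ (wienerShift t ω).1 r * β (r + (τ + t)) =
      expWeight lam δ ω.1 (r + t) * β (r + t + τ) / expWeight lam δ ω.1 t := by
    intro r
    rw [expWeight_wienerShift, show r + (τ + t) = r + t + τ by ring]; ring
  simp_rw [this]
  rw [integral_div, inv_div, div_eq_mul_inv]

lemma integrableOn_pathWeight_Iic (hβ : Continuous β) (hβ₀ : 0 < β₀)
    (hb : ∀ t, β₀ ≤ β t ∧ β t ≤ β₁) (h : IsRegularPath δ ω.1) (hlam : 0 < lam) (τ c : ℝ) :
    IntegrableOn (fun r => expWeight lam δ ω.1 r * β (r + τ)) (Set.Iic c) :=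
  integrableOn_expWeight_mul_Iic ω.1.continuous h.growth hlam (by fun_prop)
    (fun t => abs_le.2 ⟨by linarith [hb (t + τ)], (hb (t + τ)).2⟩) c

lemma integrableOn_pathWeight_Ioi (hβ : Continuous β) (hβ₀ : 0 < β₀)
    (hb : ∀ t, β₀ ≤ β t ∧ β t ≤ β₁) (h : IsRegularPath δ ω.1) (hlam : lam < 0) (τ c : ℝ) :
    IntegrableOn (fun r => expWeight lam δ ω.1 r * β (r + τ)) (Set.Ioi c) :=
  integrableOn_expWeight_mul_Ioi ω.1.continuous h.growth hlam (by fun_prop)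
    (fun t => abs_le.2 ⟨by linarith [hb (t + τ)], (hb (t + τ)).2⟩) c

lemma bifurcatingSolution_pos (hβ : Continuous β) (hβ₀ : 0 < β₀)
    (hb : ∀ t, β₀ ≤ β t ∧ β t ≤ β₁) (h : IsRegularPath δ ω.1) (hlam : 0 < lam) (τ : ℝ) :
    0 < bifurcatingSolution lam δ β τ ω := by
  rw [bifurcatingSolution_of_pos hlam, inv_pos]
  exact integral_expWeight_mul_Iic_pos (β := fun r => β (r + τ))
    (fun t => hβ₀.trans_le (hb _).1) (integrableOn_pathWeight_Iic hβ hβ₀ hb h hlam τ 0)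

lemma bifurcatingSolution_neg (hβ : Continuous β) (hβ₀ : 0 < β₀)
    (hb : ∀ t, β₀ ≤ β t ∧ β t ≤ β₁) (h : IsRegularPath δ ω.1) (hlam : lam < 0) (τ : ℝ) :
    bifurcatingSolution lam δ β τ ω < 0 := by
  rw [bifurcatingSolution_of_neg hlam, neg_lt_zero, inv_pos]
  exact integral_expWeight_mul_Ioi_pos (β := fun r => β (r + τ))
    (fun t => hβ₀.trans_le (hb _).1) (integrableOn_pathWeight_Ioi hβ hβ₀ hb h hlam τ 0)

lemma tendsto_bifurcatingSolution_nhdsGT (hβ : Continuous β) (hβ₀ : 0 < β₀)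
    (hb : ∀ t, β₀ ≤ β t ∧ β t ≤ β₁) (h : IsRegularPath δ ω.1) (τ : ℝ) :
    Tendsto (fun lam => bifurcatingSolution lam δ β τ ω) (𝓝[>] 0) (𝓝 0) := by
  refine (tendsto_inv_atTop_zero.comp (tendsto_integral_expWeight_mul_Iic_atTop
    (β := fun r => β (r + τ)) ω.1.continuous h.growth h.not_integrableOn_Iic (by fun_prop) hβ₀
    fun t => hb (t + τ))).congr' ?_
  filter_upwards [self_mem_nhdsWithin] with lam hlam
  rw [bifurcatingSolution_of_pos hlam]; rfl

lemma tendsto_bifurcatingSolution_nhdsLT (hβ : Continuous β) (hβ₀ : 0 < β₀)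
    (hb : ∀ t, β₀ ≤ β t ∧ β t ≤ β₁) (h : IsRegularPath δ ω.1) (τ : ℝ) :
    Tendsto (fun lam => bifurcatingSolution lam δ β τ ω) (𝓝[<] 0) (𝓝 0) := by
  have := (tendsto_inv_atTop_zero.comp (tendsto_integral_expWeight_mul_Ioi_atTop
    (β := fun r => β (r + τ)) ω.1.continuous h.growth h.not_integrableOn_Ioi (by fun_prop) hβ₀
    fun t => hb (t + τ))).neg
  rw [neg_zero] at this
  refine this.congr' ?_
  filter_upwards [self_mem_nhdsWithin] with lam hlam
  rw [bifurcatingSolution_of_neg hlam]; rfl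

lemma cocycle_bifurcatingSolution_of_pos (hδ : δ ≠ 0) (hβ : Continuous β) (hβ₀ : 0 < β₀)
    (hb : ∀ t, β₀ ≤ β t ∧ β t ≤ β₁) (h : IsRegularPath δ ω.1) (hlam : 0 < lam) {t : ℝ}
    (ht : 0 ≤ t) (τ : ℝ) :
    SolutionExists lam δ β (wienerShift (-τ) ω) τ (t + τ) (bifurcatingSolution lam δ β τ ω) ∧
    solutionCocycle lam δ β t τ ω (bifurcatingSolution lam δ β τ ω) =
      bifurcatingSolution lam δ β (τ + t) (wienerShift t ω) := by
  have hint := integrableOn_pathWeight_Iic hβ hβ₀ hb h hlam τ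
  have hp := bifurcatingSolution_pos hβ hβ₀ hb h hlam τ
  obtain ⟨h1, h2⟩ := cocycle_spec (lam := lam) (τ := τ) (x₀ := bifurcatingSolution lam δ β τ ω)
    hδ hβ h ht fun s hs => by
      have : 0 ≤ ∫ r in 0..s, expWeight lam δ ω.1 r * β (r + τ) :=
        intervalIntegral.integral_nonneg hs.1 fun s _ =>
          mul_nonneg (expWeight_pos _ _ _ _).le (hβ₀.le.trans (hb _).1)
      positivity
  refine ⟨h1, h2.trans ?_⟩
  rw [bifurcatingSolution_wienerShift_of_pos hlam]
  have hJt := integral_expWeight_mul_Iic_pos (β := fun r => β (r + τ))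
    (fun t => hβ₀.trans_le (hb _).1) (hint t)
  have hJ := integral_expWeight_mul_Iic_pos (β := fun r => β (r + τ))
    (fun t => hβ₀.trans_le (hb _).1) (hint 0)
  rw [← intervalIntegral.integral_Iic_sub_Iic (hint 0) (hint t), bifurcatingSolution_of_pos hlam]
  set J := ∫ r in Set.Iic 0, expWeight lam δ ω.1 r * β (r + τ)
  set Jt := ∫ r in Set.Iic t, expWeight lam δ ω.1 r * β (r + τ)
  have : 1 + J⁻¹ * (Jt - J) = Jt / J := by field_simp; ring
  rw [this]
  field_simp

lemma cocycle_bifurcatingSolution_of_neg (hδ : δ ≠ 0) (hβ : Continuous β) (hβ₀ : 0 < β₀)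
    (hb : ∀ t, β₀ ≤ β t ∧ β t ≤ β₁) (h : IsRegularPath δ ω.1) (hlam : lam < 0) {t : ℝ}
    (ht : 0 ≤ t) (τ : ℝ) :
    SolutionExists lam δ β (wienerShift (-τ) ω) τ (t + τ) (bifurcatingSolution lam δ β τ ω) ∧
    solutionCocycle lam δ β t τ ω (bifurcatingSolution lam δ β τ ω) =
      bifurcatingSolution lam δ β (τ + t) (wienerShift t ω) := by
  have hint := integrableOn_pathWeight_Ioi hβ hβ₀ hb h hlam τ
  have hJ : ∀ c, 0 < ∫ r in Set.Ioi c, expWeight lam δ ω.1 r * β (r + τ) := fun c =>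
    integral_expWeight_mul_Ioi_pos (β := fun r => β (r + τ))
      (fun t => hβ₀.trans_le (hb _).1) (hint c)
  have hden : ∀ s, 0 ≤ s → 1 + bifurcatingSolution lam δ β τ ω *
      ∫ r in 0..s, expWeight lam δ ω.1 r * β (r + τ) =
      (∫ r in Set.Ioi s, expWeight lam δ ω.1 r * β (r + τ)) /
        ∫ r in Set.Ioi 0, expWeight lam δ ω.1 r * β (r + τ) := by
    intro s hs
    rw [← intervalIntegral.integral_Ioi_sub_Ioi (hint 0) hs, bifurcatingSolution_of_neg hlam]
    have := hJ 0
    field_simp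
    ring
  obtain ⟨h1, h2⟩ := cocycle_spec (lam := lam) (τ := τ) (x₀ := bifurcatingSolution lam δ β τ ω)
    hδ hβ h ht fun s hs => by
      rw [hden s hs.1]
      exact div_pos (hJ s) (hJ 0)
  refine ⟨h1, h2.trans ?_⟩
  rw [hden t ht, bifurcatingSolution_wienerShift_of_neg hlam, bifurcatingSolution_of_neg hlam]
  have := hJ 0
  have := hJ t
  field_simp

lemma pullbackAttracts_zero_of_neg (hδ : δ ≠ 0) (hβ : Continuous β) (hβ0 : ∀ t, 0 ≤ β t)
    (hlam : lam < 0) {K : Set ℝ} (hK : IsCompact K) (hK0 : K ⊆ Set.Ioi 0) :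
    PullbackAttracts (solutionCocycle lam δ β) (fun _ _ => 0) K {ω | IsRegularPath δ ω.1} := by
  intro τ ω h ε hε
  obtain ⟨B, hB⟩ := hK.bddAbove
  obtain ⟨C, hC⟩ := h.growth.exists_abs_mul_le δ (show 0 < -lam / 2 by linarith)
  have hlim : Tendsto (fun t => (|B| + 1) * Real.exp (C + lam / 2 * t)) atTop (𝓝 0) := by
    rw [← mul_zero (|B| + 1)]
    refine Tendsto.const_mul _ (Real.tendsto_exp_atBot.comp ?_)
    exact tendsto_atBot_add_const_left _ _
      (tendsto_id.const_mul_atTop_of_neg (by linarith : lam / 2 < 0))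
  filter_upwards [hlim.eventually (gt_mem_nhds hε), eventually_ge_atTop 0] with t ht ht0 x hx
  have hx0 : 0 < x := hK0 hx
  have hE := expWeight_pos lam δ ω.1 (-t)
  have hI : 0 ≤ ∫ r in (-t)..0, expWeight lam δ ω.1 r * β (r + τ) :=
    intervalIntegral.integral_nonneg (by linarith) fun s _ =>
      mul_nonneg (expWeight_pos _ _ _ _).le (hβ0 _)
  rw [cocycle_pullback hδ hβ hβ0 h ht0 hx0.le, sub_zero, abs_of_nonneg (by positivity)]
  refine lt_of_le_of_lt ?_ ht
  rw [div_le_iff₀ (by positivity)]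
  have h1 : x ≤ |B| + 1 := (hB hx).trans (by linarith [le_abs_self B])
  have h2 : 1 ≤ Real.exp (C + lam / 2 * t) * expWeight lam δ ω.1 (-t) := by
    rw [expWeight, ← Real.exp_add, Real.one_le_exp_iff]
    have := hC (-t)
    rw [abs_neg, abs_of_nonneg ht0] at this
    have := neg_abs_le (δ * ω.1 (-t))
    linarith
  have h3 := Real.exp_pos (C + lam / 2 * t)
  calc x ≤ (|B| + 1) * 1 := by linarith
    _ ≤ (|B| + 1) * (Real.exp (C + lam / 2 * t) * expWeight lam δ ω.1 (-t)) := by gcongr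
    _ ≤ (|B| + 1) * Real.exp (C + lam / 2 * t) * (expWeight lam δ ω.1 (-t) +
        x * ∫ r in (-t)..0, expWeight lam δ ω.1 r * β (r + τ)) := by
      rw [← mul_assoc]
      gcongr
      have : 0 ≤ x * ∫ r in (-t)..0, expWeight lam δ ω.1 r * β (r + τ) := by positivity
      linarith

lemma pullbackLyapunovStableAt_of_neg (hδ : δ ≠ 0) (hβ : Continuous β) (hβ0 : ∀ t, 0 ≤ β t)
    (h : IsRegularPath δ ω.1) (hlam : lam < 0) (τ : ℝ) :
    PullbackLyapunovStableAt (solutionCocycle lam δ β) 0 (Set.Ioi 0) τ ω := by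
  intro ε hε
  obtain ⟨C, hC⟩ := h.growth.exists_abs_mul_le δ (show 0 < -lam by linarith)
  refine ⟨ε * Real.exp (-C), by positivity, fun t ht x hx => ?_⟩
  obtain ⟨hx1, hx0⟩ := hx
  have hx0 : 0 < x := hx0
  rw [mem_ball_zero_iff, Real.norm_eq_abs, abs_of_pos hx0] at hx1
  have hE := expWeight_pos lam δ ω.1 (-t)
  have hI : 0 ≤ ∫ r in (-t)..0, expWeight lam δ ω.1 r * β (r + τ) :=
    intervalIntegral.integral_nonneg (by linarith) fun s _ =>
      mul_nonneg (expWeight_pos _ _ _ _).le (hβ0 _)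
  rw [cocycle_pullback hδ hβ hβ0 h ht hx0.le]
  have hpos : 0 < x / (expWeight lam δ ω.1 (-t) +
      x * ∫ r in (-t)..0, expWeight lam δ ω.1 r * β (r + τ)) := by positivity
  refine ⟨?_, hpos⟩
  rw [mem_ball_zero_iff, Real.norm_eq_abs, abs_of_pos hpos, div_lt_iff₀ (by positivity)]
  refine hx1.trans_le ?_
  gcongr
  have h1 : Real.exp (-C) ≤ expWeight lam δ ω.1 (-t) := by
    rw [expWeight, Real.exp_le_exp]
    have := hC (-t)
    rw [abs_neg, abs_of_nonneg ht] at this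
    have := neg_abs_le (δ * ω.1 (-t))
    linarith
  have : 0 ≤ x * ∫ r in (-t)..0, expWeight lam δ ω.1 r * β (r + τ) := by positivity
  linarith

lemma pullbackAttracts_bifurcatingSolution (hδ : δ ≠ 0) (hβ : Continuous β) (hβ₀ : 0 < β₀)
    (hb : ∀ t, β₀ ≤ β t ∧ β t ≤ β₁)
    (hlam : 0 < lam) {K : Set ℝ} (hK : IsCompact K) (hK0 : K ⊆ Set.Ioi 0) :
    PullbackAttracts (solutionCocycle lam δ β) (bifurcatingSolution lam δ β) K
      {ω | IsRegularPath δ ω.1} := by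
  intro τ ω h ε hε
  obtain ⟨m, hm0, hm⟩ : ∃ m > 0, ∀ x ∈ K, m ≤ x := by
    rcases K.eq_empty_or_nonempty with rfl | hne
    · exact ⟨1, one_pos, by simp⟩
    · obtain ⟨m, hm⟩ := hK.exists_isLeast hne
      exact ⟨m, hK0 hm.1, fun x hx => hm.2 hx⟩
  have hint := integrableOn_pathWeight_Iic hβ hβ₀ hb h hlam τ 0
  have hJ : 0 < ∫ r in Set.Iic 0, expWeight lam δ ω.1 r * β (r + τ) :=
    integral_expWeight_mul_Iic_pos (β := fun r => β (r + τ))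
      (fun t => hβ₀.trans_le (hb _).1) hint
  have hJt : Tendsto (fun t : ℝ => ∫ r in (-t)..0, expWeight lam δ ω.1 r * β (r + τ)) atTop
      (𝓝 (∫ r in Set.Iic 0, expWeight lam δ ω.1 r * β (r + τ))) :=
    intervalIntegral_tendsto_integral_Iic 0 hint tendsto_neg_atTop_atBot
  rw [bifurcatingSolution_of_pos hlam]
  set J := ∫ r in Set.Iic 0, expWeight lam δ ω.1 r * β (r + τ) with hJdef
  have hE : Tendsto (fun t : ℝ => expWeight lam δ ω.1 (-t)) atTop (𝓝 0) := by
    obtain ⟨C, hC⟩ := h.growth.exists_abs_mul_le δ (half_pos hlam)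
    have hlim : Tendsto (fun t => Real.exp (C + -(lam / 2) * t)) atTop (𝓝 0) :=
      Real.tendsto_exp_atBot.comp (tendsto_atBot_add_const_left _ _
        (tendsto_id.const_mul_atTop_of_neg (by linarith : -(lam / 2) < 0)))
    refine tendsto_of_tendsto_of_tendsto_of_le_of_le' tendsto_const_nhds hlim
      (Eventually.of_forall fun t => (expWeight_pos _ _ _ _).le) ?_
    filter_upwards [eventually_ge_atTop 0] with t ht
    rw [expWeight, Real.exp_le_exp]
    have := hC (-t)
    rw [abs_neg, abs_of_nonneg ht] at this
    have := le_abs_self (δ * ω.1 (-t))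
    linarith
  have hlim : Tendsto (fun t : ℝ =>
      ((J - ∫ r in (-t)..0, expWeight lam δ ω.1 r * β (r + τ)) + expWeight lam δ ω.1 (-t) / m) /
        ((∫ r in (-t)..0, expWeight lam δ ω.1 r * β (r + τ)) * J)) atTop (𝓝 0) := by
    have := (((tendsto_const_nhds (x := J)).sub hJt).add (hE.div_const m)).div (hJt.mul_const J)
      (mul_pos hJ hJ).ne'
    rw [sub_self, zero_div, add_zero, zero_div] at this
    exact this
  filter_upwards [hlim.eventually (gt_mem_nhds hε), eventually_ge_atTop 0,
    hJt.eventually (lt_mem_nhds hJ)] with t ht ht0 hpos x hx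
  have hx0 : 0 < x := hK0 hx
  have hEp := expWeight_pos lam δ ω.1 (-t)
  have hle : ∫ r in (-t)..0, expWeight lam δ ω.1 r * β (r + τ) ≤ J := by
    rw [intervalIntegral.integral_of_le (by linarith)]
    exact setIntegral_mono_set hint (ae_of_all _ fun r =>
      mul_nonneg (expWeight_pos _ _ _ _).le (hβ₀.le.trans (hb _).1))
      (Set.Ioc_subset_Iic_self).eventuallyLE
  rw [cocycle_pullback hδ hβ (fun t => hβ₀.le.trans (hb t).1) h ht0 hx0.le]
  refine lt_of_le_of_lt ?_ ht
  set I := ∫ r in (-t)..0, expWeight lam δ ω.1 r * β (r + τ)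
  set E := expWeight lam δ ω.1 (-t)
  have hid : x / (E + x * I) - J⁻¹ = ((J - I) - E / x) / ((E / x + I) * J) := by
    field_simp
    ring
  have hEx : E / x ≤ E / m := by gcongr; exact hm x hx
  rw [hid, abs_div, abs_of_pos (by positivity : 0 < (E / x + I) * J)]
  have h1 : |J - I - E / x| ≤ (J - I) + E / m := by
    have : 0 < E / x := by positivity
    rw [abs_le]; constructor <;> linarith
  have h2 : I * J ≤ (E / x + I) * J := by
    gcongr
    have : 0 < E / x := by positivity
    linarith
  have h3 : 0 ≤ (J - I) + E / m := by
    have : 0 < E / m := by positivity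
    linarith
  exact div_le_div₀ h3 h1 (by positivity) h2

lemma tendsto_of_pullbackAttracts_singleton {Φ : ℝ → ℝ → PathSpace → ℝ → ℝ}
    {ξ : ℝ → PathSpace → ℝ} {Ω' : Set PathSpace} {x : ℝ} (h : PullbackAttracts Φ ξ {x} Ω')
    (τ : ℝ) (hω : ω ∈ Ω') :
    Tendsto (fun t => Φ t (τ - t) (wienerShift (-t) ω) x) atTop (𝓝 (ξ τ ω)) := by
  rw [Metric.tendsto_nhds]
  intro ε hε
  filter_upwards [h τ ω hω ε hε] with t ht
  exact ht x rfl

lemma not_pullbackLyapunovStableAt_of_pos (hδ : δ ≠ 0) (hβ : Continuous β) (hβ₀ : 0 < β₀)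
    (hb : ∀ t, β₀ ≤ β t ∧ β t ≤ β₁) (h : IsRegularPath δ ω.1) (hlam : 0 < lam) (τ : ℝ) :
    ¬ PullbackLyapunovStableAt (solutionCocycle lam δ β) 0 (Set.Ioi 0) τ ω := by
  intro hst
  have hp := bifurcatingSolution_pos hβ hβ₀ hb h hlam τ
  obtain ⟨η, hη, H⟩ := hst (bifurcatingSolution lam δ β τ ω / 2) (by positivity)
  have hη' : (0 : ℝ) < η / 2 := by positivity
  have hlim := tendsto_of_pullbackAttracts_singleton (x := η / 2)
    (pullbackAttracts_bifurcatingSolution hδ hβ hβ₀ hb hlam isCompact_singleton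
      (Set.singleton_subset_iff.2 hη')) τ h
  have hev := hlim.eventually (lt_mem_nhds (half_lt_self hp))
  obtain ⟨t, ht, ht0⟩ := (hev.and (eventually_ge_atTop 0)).exists
  have hmem : η / 2 ∈ Metric.ball (0 : ℝ) η ∩ Set.Ioi 0 := by
    refine ⟨?_, hη'⟩
    rw [mem_ball_zero_iff, Real.norm_eq_abs, abs_of_pos hη']
    linarith
  have := (H t ht0 _ hmem).1
  rw [mem_ball_zero_iff, Real.norm_eq_abs] at this
  exact absurd (lt_of_abs_lt this) ht.not_gt

end Bifurcating

lemma abs_floor_le {x : ℝ} : |(⌊x⌋ : ℝ)| ≤ |x| + 1 := by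
  have h1 := Int.floor_le x
  have h2 := Int.lt_floor_add_one x
  rw [abs_le]
  constructor <;> linarith [le_abs_self x, neg_abs_le x]

/-- Dyadic chaining: bounds on dyadic increments give a modulus of continuity. -/
lemma abs_sub_le_of_dyadic {f : ℝ → ℝ} (hf : Continuous f) {r A R : ℝ} (hr0 : 0 ≤ r) (hr1 : r < 1)
    (hA : 0 ≤ A)
    (h : ∀ (n : ℕ) (j : ℤ), |(j : ℝ)| ≤ 2 ^ n * (R + 1) →
      |f ((j + 1) / 2 ^ n) - f (j / 2 ^ n)| ≤ A * r ^ n)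
    (n : ℕ) {s t : ℝ} (hs : |s| ≤ R) (ht : |t| ≤ R) (hst : |t - s| ≤ (1 / 2) ^ n) :
    |f t - f s| ≤ A * (1 + 2 / (1 - r)) * r ^ n := by
  have approx : ∀ t : ℝ, |t| ≤ R → |f t - f (⌊2 ^ n * t⌋ / 2 ^ n)| ≤ A * r ^ n / (1 - r) := by
    intro t ht
    have hlim : Tendsto (fun m : ℕ => f ((⌊(2 : ℝ) ^ m * t⌋ : ℝ) / 2 ^ m)) atTop (𝓝 (f t)) := by
      refine (hf.tendsto t).comp ?_
      have h0 : Tendsto (fun m : ℕ => t - (1 / 2 : ℝ) ^ m) atTop (𝓝 t) := by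
        simpa using tendsto_const_nhds.sub
          (tendsto_pow_atTop_nhds_zero_of_lt_one (by norm_num : (0 : ℝ) ≤ 1 / 2) (by norm_num))
      refine tendsto_of_tendsto_of_tendsto_of_le_of_le h0 tendsto_const_nhds (fun m => ?_)
        fun m => ?_
      · have := (Int.lt_floor_add_one ((2 : ℝ) ^ m * t)).le
        have hp : (0 : ℝ) < 2 ^ m := by positivity
        change t - (1 / 2 : ℝ) ^ m ≤ _
        rw [le_div_iff₀ hp, sub_mul, ← mul_pow]
        norm_num
        linarith
      · have := Int.floor_le ((2 : ℝ) ^ m * t)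
        have hp : (0 : ℝ) < 2 ^ m := by positivity
        change _ ≤ t
        rw [div_le_iff₀ hp]
        linarith
    have hstep : ∀ m : ℕ, dist (f ((⌊(2 : ℝ) ^ m * t⌋ : ℝ) / 2 ^ m))
        (f ((⌊(2 : ℝ) ^ (m + 1) * t⌋ : ℝ) / 2 ^ (m + 1))) ≤ A * r ^ m := by
      intro m
      set k := ⌊(2 : ℝ) ^ m * t⌋ with hk
      have hp : (0 : ℝ) < 2 ^ m := by positivity
      have h1 := Int.floor_le ((2 : ℝ) ^ m * t)
      have h2 := Int.lt_floor_add_one ((2 : ℝ) ^ m * t)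
      have hcases : ⌊(2 : ℝ) ^ (m + 1) * t⌋ = 2 * k ∨ ⌊(2 : ℝ) ^ (m + 1) * t⌋ = 2 * k + 1 := by
        have l1 : 2 * k ≤ ⌊(2 : ℝ) ^ (m + 1) * t⌋ := by
          rw [Int.le_floor]; push_cast; rw [pow_succ]; linarith
        have l2 : ⌊(2 : ℝ) ^ (m + 1) * t⌋ < 2 * k + 2 := by
          rw [Int.floor_lt]; push_cast; rw [pow_succ]; linarith
        omega
      have heq : (k : ℝ) / 2 ^ m = ((2 * k : ℤ) : ℝ) / 2 ^ (m + 1) := by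
        push_cast; rw [pow_succ]; field_simp
      rcases hcases with h3 | h3
      · rw [h3, heq, dist_self]; positivity
      · rw [h3, heq, dist_comm, Real.dist_eq]
        have hkb : |((2 * k : ℤ) : ℝ)| ≤ 2 ^ (m + 1) * (R + 1) := by
          have := abs_floor_le (x := (2 : ℝ) ^ m * t)
          rw [abs_mul, abs_of_pos hp, ← hk] at this
          push_cast
          rw [abs_mul, abs_two, pow_succ]
          have h5 : (1 : ℝ) ≤ 2 ^ m := one_le_pow₀ (by norm_num)
          have h6 : (2 : ℝ) ^ m * |t| ≤ 2 ^ m * R := by gcongr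
          nlinarith
        have := h (m + 1) (2 * k) hkb
        push_cast at this ⊢
        refine this.trans ?_
        gcongr A * ?_
        exact pow_le_pow_of_le_one hr0 hr1.le (Nat.le_succ m)
    have := dist_le_of_le_geometric_of_tendsto r A hr1 hstep hlim n
    rwa [dist_comm, Real.dist_eq] at this
  have main : ∀ s t : ℝ, |s| ≤ R → |t| ≤ R → s ≤ t → t - s ≤ (1 / 2) ^ n →
      |f t - f s| ≤ A * (1 + 2 / (1 - r)) * r ^ n := by
    intro s t hs ht hle hst
    have a1 := approx s hs
    have a2 := approx t ht
    have hp : (0 : ℝ) < 2 ^ n := by positivity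
    have a3 : |f (⌊2 ^ n * t⌋ / 2 ^ n) - f (⌊2 ^ n * s⌋ / 2 ^ n)| ≤ A * r ^ n := by
      have h1 := Int.floor_le ((2 : ℝ) ^ n * s)
      have h2 := Int.lt_floor_add_one ((2 : ℝ) ^ n * s)
      have h3 : (2 : ℝ) ^ n * t ≤ 2 ^ n * s + 1 := by
        have h4 : (2 : ℝ) ^ n * (1 / 2) ^ n = 1 := by rw [← mul_pow]; norm_num
        nlinarith
      have hcases : ⌊(2 : ℝ) ^ n * t⌋ = ⌊(2 : ℝ) ^ n * s⌋ ∨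
          ⌊(2 : ℝ) ^ n * t⌋ = ⌊(2 : ℝ) ^ n * s⌋ + 1 := by
        have l1 : ⌊(2 : ℝ) ^ n * s⌋ ≤ ⌊(2 : ℝ) ^ n * t⌋ :=
          Int.floor_le_floor (by gcongr)
        have l2 : ⌊(2 : ℝ) ^ n * t⌋ < ⌊(2 : ℝ) ^ n * s⌋ + 2 := by
          rw [Int.floor_lt]; push_cast; linarith
        omega
      rcases hcases with h5 | h5
      · rw [h5, sub_self, abs_zero]; positivity
      · rw [h5]
        push_cast
        refine h n _ ?_
        have := abs_floor_le (x := (2 : ℝ) ^ n * s)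
        rw [abs_mul, abs_of_pos hp] at this
        have h5 : (1 : ℝ) ≤ 2 ^ n := one_le_pow₀ (by norm_num)
        have h6 : (2 : ℝ) ^ n * |s| ≤ 2 ^ n * R := by gcongr
        linarith
    have e : A * (1 + 2 / (1 - r)) * r ^ n = A * r ^ n + A * r ^ n / (1 - r) +
        A * r ^ n / (1 - r) := by ring
    rw [e]
    rw [abs_le] at *
    constructor <;> linarith
  rcases le_total s t with hle | hle
  · exact main s t hs ht hle (by rwa [abs_of_nonneg (by linarith)] at hst)
  · rw [abs_sub_comm]
    exact main t s ht hs hle (by rwa [abs_of_nonpos (by linarith), neg_sub] at hst)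

/-- Polynomially growing bounds on the dyadic increments of `w`, of Hölder order larger than
`1 / 3`. -/
def DyadicIncrementBound (w : ℝ → ℝ) : Prop :=
  ∃ C : ℝ, 0 ≤ C ∧ ∀ (n : ℕ) (j : ℤ), |w ((j + 1) / 2 ^ n) - w (j / 2 ^ n)| ^ 16 ≤
    C * (((39 / 50 : ℝ) ^ 16) ^ n * (1 + |(j : ℝ)|) ^ 2 / 4 ^ n)

lemma DyadicIncrementBound.exists_modulus {w : ℝ → ℝ} (h : DyadicIncrementBound w)
    (hw : Continuous w) :
    ∃ C : ℝ, 0 ≤ C ∧ ∀ R : ℝ, 0 ≤ R → ∃ A : ℝ, 0 ≤ A ∧ A ^ 16 ≤ C * (R + 2) ^ 2 ∧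
      ∀ (n : ℕ) (s t : ℝ), |s| ≤ R → |t| ≤ R → |t - s| ≤ (1 / 2) ^ n →
        |w t - w s| ≤ A * (39 / 50) ^ n := by
  obtain ⟨C, hC, H⟩ := h
  refine ⟨C * (1 + 2 / (1 - 39 / 50)) ^ 16, by positivity, fun R hR => ?_⟩
  set A := (C * (R + 2) ^ 2) ^ ((16 : ℕ) : ℝ)⁻¹ with hAdef
  have hA : 0 ≤ A := by positivity
  have hA16 : A ^ 16 = C * (R + 2) ^ 2 := Real.rpow_inv_natCast_pow (by positivity) (by norm_num)
  refine ⟨A * (1 + 2 / (1 - 39 / 50)), by positivity, by rw [mul_pow, hA16]; ring_nf; rfl,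
    fun n s t hs ht hst => abs_sub_le_of_dyadic hw (by norm_num) (by norm_num) hA
      (fun n j hj => ?_) n hs ht hst⟩
  refine le_of_pow_le_pow_left₀ (n := 16) (by norm_num) (by positivity) ((H n j).trans ?_)
  have h1 : (1 : ℝ) ≤ 2 ^ n := one_le_pow₀ (by norm_num)
  have h2 : (1 + |(j : ℝ)|) ^ 2 ≤ 4 ^ n * (R + 2) ^ 2 := by
    have : (4 : ℝ) ^ n = (2 ^ n) ^ 2 := by rw [← pow_mul, mul_comm, pow_mul]; norm_num
    rw [this, ← mul_pow]
    gcongr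
    linarith
  have h3 : ((39 / 50 : ℝ) ^ 16) ^ n = ((39 / 50 : ℝ) ^ n) ^ 16 := by
    rw [← pow_mul, ← pow_mul, mul_comm]
  rw [mul_pow, hA16, h3]
  calc C * (((39 / 50 : ℝ) ^ n) ^ 16 * (1 + |(j : ℝ)|) ^ 2 / 4 ^ n)
      ≤ C * (((39 / 50 : ℝ) ^ n) ^ 16 * (4 ^ n * (R + 2) ^ 2) / 4 ^ n) := by gcongr
    _ = _ := by field_simp

lemma DyadicIncrementBound.vanishingCubicVariation {w : ℝ → ℝ} (h : DyadicIncrementBound w)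
    (hw : Continuous w) : VanishingCubicVariation w := by
  obtain ⟨_, _, H⟩ := h.exists_modulus hw
  intro R ε hε
  rcases lt_or_ge R 0 with hR | hR
  · exact ⟨1, one_pos, fun s t hs _ _ => absurd ((abs_nonneg s).trans hs) hR.not_ge⟩
  obtain ⟨A, hA, -, HA⟩ := H R hR
  set θ : ℝ := 2 * (39 / 50) ^ 3 with hθ
  have hθ0 : 0 ≤ θ := by positivity
  have hθ1 : θ < 1 := by rw [hθ]; norm_num
  obtain ⟨N, hN⟩ := exists_pow_lt_of_lt_one (show 0 < ε / (2 * A ^ 3 + 1) by positivity) hθ1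
  refine ⟨(1 / 2) ^ N, by positivity, fun s t hs ht hst => ?_⟩
  rcases eq_or_ne s t with rfl | hne
  · simp
  have hpos : 0 < |t - s| := abs_pos.2 (sub_ne_zero.2 hne.symm)
  obtain ⟨n, hn1, hn2⟩ := exists_nat_pow_near_of_lt_one hpos
    (hst.le.trans (pow_le_one₀ (by norm_num) (by norm_num))) (by norm_num : (0 : ℝ) < 1 / 2)
    (by norm_num)
  have hNn : N ≤ n := by
    have := (pow_lt_pow_iff_right_of_lt_one₀ (by norm_num : (0 : ℝ) < 1 / 2) (by norm_num)).1
      (hn1.trans hst)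
    omega
  have hb := HA n s t hs ht hn2
  have e : (A * (39 / 50 : ℝ) ^ n) ^ 3 = A ^ 3 * θ ^ n * (2 * (1 / 2) ^ (n + 1)) := by
    have h1 : (1 / 2 : ℝ) ^ (n + 1) * 2 = (1 / 2) ^ n := by rw [pow_succ]; ring
    have h2 : θ ^ n * (1 / 2) ^ n = ((39 / 50 : ℝ) ^ n) ^ 3 := by
      rw [← mul_pow, hθ, ← pow_mul, mul_comm n 3, pow_mul]
      congr 1
      ring
    rw [mul_pow, mul_comm 2, h1, mul_assoc, h2]
  have hθn : θ ^ n * (2 * A ^ 3 + 1) ≤ ε := by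
    have := (pow_le_pow_of_le_one hθ0 hθ1.le hNn).trans hN.le
    rwa [le_div_iff₀ (by positivity)] at this
  calc |w t - w s| ^ 3 ≤ (A * (39 / 50 : ℝ) ^ n) ^ 3 := by gcongr
    _ = A ^ 3 * θ ^ n * (2 * (1 / 2) ^ (n + 1)) := e
    _ ≤ A ^ 3 * θ ^ n * (2 * |t - s|) := by gcongr
    _ = (θ ^ n * (2 * A ^ 3)) * |t - s| := by ring
    _ ≤ ε * |t - s| := by
      gcongr
      have : 0 ≤ θ ^ n := by positivity
      nlinarith

lemma DyadicIncrementBound.exists_oscillation_le {w : ℝ → ℝ} (h : DyadicIncrementBound w)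
    (hw : Continuous w) :
    ∃ C : ℝ, 0 ≤ C ∧ ∀ s t : ℝ, |t - s| ≤ 1 → |w t - w s| ^ 16 ≤ C * (|s| + 3) ^ 2 := by
  obtain ⟨C, hC, H⟩ := h.exists_modulus hw
  refine ⟨C, hC, fun s t hst => ?_⟩
  obtain ⟨A, hA, hA16, HA⟩ := H (|s| + 1) (by positivity)
  have ht : |t| ≤ |s| + 1 := by
    have := abs_add_le (t - s) s
    rw [sub_add_cancel] at this
    linarith
  have := HA 0 s t (by linarith) ht (by simpa using hst)
  rw [pow_zero, mul_one] at this
  calc |w t - w s| ^ 16 ≤ A ^ 16 := by gcongr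
    _ ≤ _ := hA16
    _ = _ := by ring

lemma exists_le_add_mul_of_pow_le {D ε : ℝ} (hD : 0 ≤ D) (hε : 0 < ε) :
    ∃ C : ℝ, 0 ≤ C ∧ ∀ y u : ℝ, 0 < u → 0 ≤ y → y ^ 16 ≤ D * u ^ 10 → y ≤ C + ε * u := by
  refine ⟨D / ε ^ 10 + 1, by positivity, fun y u hu hy h => ?_⟩
  by_contra! hlt
  have hC1 : 1 ≤ D / ε ^ 10 + 1 := by linarith [show 0 ≤ D / ε ^ 10 by positivity]
  have h1 : (ε * u) ^ 10 ≤ y ^ 10 := by gcongr; linarith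
  have h2 : D / ε ^ 10 + 1 ≤ y ^ 6 :=
    calc D / ε ^ 10 + 1 ≤ (D / ε ^ 10 + 1) ^ 6 := le_self_pow₀ hC1 (by norm_num)
      _ ≤ y ^ 6 := by gcongr; linarith [mul_pos hε hu]
  have h3 : (ε * u) ^ 10 * (D / ε ^ 10 + 1) ≤ y ^ 16 :=
    calc _ ≤ y ^ 10 * y ^ 6 := by gcongr
      _ = _ := by ring
  have h4 : (ε * u) ^ 10 * (D / ε ^ 10 + 1) = D * u ^ 10 + (ε * u) ^ 10 := by
    rw [mul_pow]; field_simp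
  have h5 : 0 < (ε * u) ^ 10 := by positivity
  linarith

lemma DyadicIncrementBound.sublinearGrowth {w : ℝ → ℝ} (h : DyadicIncrementBound w)
    (hw : Continuous w)
    (hint : ∃ C : ℝ, 0 ≤ C ∧ ∀ m : ℤ, |w m| ^ 16 ≤ C * (1 + |(m : ℝ)|) ^ 10) :
    SublinearGrowth w := by
  obtain ⟨C₁, hC₁, H₁⟩ := h.exists_oscillation_le hw
  obtain ⟨C₂, hC₂, H₂⟩ := hint
  intro ε hε
  obtain ⟨D₁, hD₁, K₁⟩ := exists_le_add_mul_of_pow_le hC₁ (half_pos hε)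
  obtain ⟨D₂, hD₂, K₂⟩ := exists_le_add_mul_of_pow_le hC₂ (half_pos hε)
  refine ⟨D₁ + D₂ + 3 * ε, fun t => ?_⟩
  have hfl := abs_floor_le (x := t)
  have b₂ := K₂ _ _ (by positivity) (abs_nonneg _) (H₂ ⌊t⌋)
  have b₁ := K₁ |w t - w ⌊t⌋| (|(⌊t⌋ : ℝ)| + 3) (by positivity) (abs_nonneg _) (by
    refine (H₁ ⌊t⌋ t ?_).trans ?_
    · rw [abs_le]
      constructor <;> linarith [Int.floor_le t, Int.lt_floor_add_one t]
    · gcongr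
      · linarith [abs_nonneg (⌊t⌋ : ℝ)]
      · norm_num)
  have := abs_add_le (w t - w ⌊t⌋) (w ⌊t⌋)
  rw [sub_add_cancel] at this
  nlinarith

lemma DyadicIncrementBound.frequently_nonneg {w : ℝ → ℝ} (h : DyadicIncrementBound w)
    (hw : Continuous w) (hg : SublinearGrowth w)
    (hf : ∃ᶠ k : ℕ in atTop, √((2 : ℝ) ^ 3 ^ (k + 1) - 2 ^ 3 ^ k) ≤
      w (2 ^ 3 ^ (k + 1)) - w (2 ^ 3 ^ k)) :
    ∃ᶠ T : ℝ in atTop, ∀ s ∈ Set.Icc T (T + 1), 0 ≤ w s := by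
  obtain ⟨C₁, hC₁, H₁⟩ := h.exists_oscillation_le hw
  obtain ⟨D₁, hD₁, K₁⟩ := exists_le_add_mul_of_pow_le (D := C₁ * 16) (by positivity)
    (show (0 : ℝ) < 1 / 4 by norm_num)
  obtain ⟨D₂, hD₂⟩ := hg (1 / 4) (by norm_num)
  have hN : Tendsto (fun k : ℕ => (2 : ℝ) ^ 3 ^ k) atTop atTop :=
    (tendsto_pow_atTop_atTop_of_one_lt (by norm_num : (1 : ℝ) < 2)).comp
      (tendsto_pow_atTop_atTop_of_one_lt (by norm_num : (1 : ℕ) < 3))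
  have hN' : Tendsto (fun k : ℕ => (2 : ℝ) ^ 3 ^ (k + 1)) atTop atTop :=
    hN.comp (tendsto_add_atTop_nat 1)
  refine hN'.frequently (((hN.eventually_ge_atTop (2 * (D₁ + D₂) + 2)).and_frequently hf).mono ?_)
  rintro k ⟨hk, hinc⟩ s hs
  have hcube : (2 : ℝ) ^ 3 ^ (k + 1) = (2 ^ 3 ^ k) ^ 3 := by rw [pow_succ 3 k, pow_mul]
  have hN2 : (2 : ℝ) ≤ 2 ^ 3 ^ k := by
    calc (2 : ℝ) = 2 ^ 1 := (pow_one _).symm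
      _ ≤ _ := pow_le_pow_right₀ (by norm_num) (Nat.one_le_pow _ _ (by norm_num))
  rw [hcube] at hinc hs
  set N : ℝ := 2 ^ 3 ^ k
  have h1 : N ≤ √(N ^ 3 - N) := Real.le_sqrt_of_sq_le (by nlinarith [sq_nonneg N])
  have h2 := hD₂ N
  rw [abs_of_nonneg (by linarith : 0 ≤ N)] at h2
  have h3 := neg_abs_le (w N)
  have h4 := K₁ |w s - w (N ^ 3)| N (by linarith) (abs_nonneg _) (by
    refine (H₁ (N ^ 3) s ?_).trans ?_
    · rw [abs_of_nonneg (by linarith [hs.1])]; linarith [hs.2]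
    · have hN3 : (0 : ℝ) ≤ N ^ 3 := by positivity
      rw [abs_of_nonneg hN3, mul_assoc]
      gcongr
      have : (3 : ℝ) ≤ 3 * N ^ 3 := by nlinarith [one_le_pow₀ (n := 3) (by linarith : 1 ≤ N)]
      calc (N ^ 3 + 3) ^ 2 ≤ (4 * N ^ 3) ^ 2 := by gcongr; linarith
        _ = 16 * N ^ 6 := by ring
        _ ≤ 16 * N ^ 10 := by
          gcongr 16 * ?_
          exact pow_le_pow_right₀ (by linarith) (by norm_num))
  have h5 := neg_abs_le (w s - w (N ^ 3))
  linarith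

lemma not_integrableOn_exp_Ioi {w : ℝ → ℝ} (hw : Continuous w) {δ : ℝ} (hδ : 0 ≤ δ)
    (hf : ∃ᶠ T : ℝ in atTop, ∀ s ∈ Set.Icc T (T + 1), 0 ≤ w s) :
    ¬ IntegrableOn (fun r => Real.exp (δ * w r)) (Set.Ioi 0) := by
  intro hi
  have hE : Continuous fun r => Real.exp (δ * w r) := by fun_prop
  have hlim : Tendsto (fun T : ℝ => ∫ r in Set.Ioi T, Real.exp (δ * w r)) atTop (𝓝 0) :=
    tendsto_integral_Ioi_zero tendsto_id
  obtain ⟨T, hT, hT1, hT0⟩ := (hf.and_eventually ((hlim.eventually (gt_mem_nhds one_pos)).and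
    (eventually_ge_atTop 0))).exists
  refine hT1.not_ge ?_
  have h1 : ∫ r in T..(T + 1), (1 : ℝ) ≤ ∫ r in T..(T + 1), Real.exp (δ * w r) :=
    intervalIntegral.integral_mono_on (by linarith) intervalIntegrable_const
      (hE.intervalIntegrable _ _) fun r hr => Real.one_le_exp (mul_nonneg hδ (hT r hr))
  rw [intervalIntegral.integral_const, add_sub_cancel_left, one_smul,
    intervalIntegral.integral_of_le (by linarith)] at h1
  exact h1.trans (setIntegral_mono_set (hi.mono_set (Set.Ioi_subset_Ioi hT0))
    (ae_of_all _ fun r => (Real.exp_pos _).le) Set.Ioc_subset_Ioi_self.eventuallyLE)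

lemma not_integrableOn_exp_Iic {w : ℝ → ℝ} (hw : Continuous w) {δ : ℝ} (hδ : 0 ≤ δ)
    (hf : ∃ᶠ T : ℝ in atTop, ∀ s ∈ Set.Icc T (T + 1), 0 ≤ w (-s)) :
    ¬ IntegrableOn (fun r => Real.exp (δ * w r)) (Set.Iic 0) := by
  intro hi
  refine not_integrableOn_exp_Ioi (w := fun s => w (-s)) (by fun_prop) hδ hf ?_
  have := hi.comp_neg
  rw [Set.neg_Iic, neg_zero] at this
  exact this.mono_set Set.Ioi_subset_Ici_self

/-- A quantitative form of the first Borel–Cantelli lemma. -/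
lemma ae_exists_forall_le_of_summable {Ω ι : Type*} [Countable ι] [MeasurableSpace Ω] {P : Measure Ω}
    {X : ι → Ω → ℝ} {p : ι → ℝ} (hp : Summable p)
    (hX : ∀ i, P {ω | 1 ≤ X i ω} ≤ ENNReal.ofReal (p i)) :
    ∀ᵐ ω ∂P, ∃ C : ℝ, 0 ≤ C ∧ ∀ i, X i ω ≤ C := by
  have hsum : ∑' i, P {ω | 1 ≤ X i ω} ≠ ⊤ :=
    ne_top_of_le_ne_top hp.tsum_ofReal_ne_top (ENNReal.tsum_le_tsum hX)
  filter_upwards [ae_finite_setOfPred_mem hsum] with ω hω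
  refine ⟨1 + ∑ i ∈ hω.toFinset, |X i ω|, by positivity, fun i => ?_⟩
  by_cases h : 1 ≤ X i ω
  · have := Finset.single_le_sum (f := fun i => |X i ω|) (fun i _ => abs_nonneg _)
      (hω.mem_toFinset.2 h)
    linarith [le_abs_self (X i ω)]
  · have : 0 ≤ ∑ i ∈ hω.toFinset, |X i ω| := by positivity
    linarith

lemma gaussianReal_zero_eq_map (v : NNReal) :
    gaussianReal 0 v = (gaussianReal 0 1).map (√v * ·) := by
  rw [gaussianReal_map_const_mul, mul_zero, mul_one]
  congr 1
  ext
  simp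

lemma gaussianReal_tail_le (v : NNReal) {c : ℝ} (hc : 0 < c) :
    gaussianReal 0 v {x | c ≤ |x| ^ 16} ≤
      ENNReal.ofReal ((∫ x, |x| ^ 16 ∂(gaussianReal 0 1)) * (v : ℝ) ^ 8 / c) := by
  have hint : Integrable (fun x : ℝ => (v : ℝ) ^ 8 * |x| ^ 16) (gaussianReal 0 1) := by
    have := (memLp_id_gaussianReal (μ := 0) (v := 1) 16).integrable_norm_pow (p := 16)
      (by norm_num)
    exact this.const_mul _
  have hM := mul_meas_ge_le_integral_of_nonneg (ae_of_all _ fun x => by positivity) hint c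
  rw [integral_const_mul] at hM
  have hset : gaussianReal 0 v {x | c ≤ |x| ^ 16} =
      gaussianReal 0 1 {x | c ≤ (v : ℝ) ^ 8 * |x| ^ 16} := by
    rw [gaussianReal_zero_eq_map v, Measure.map_apply (by fun_prop)
      (measurableSet_le measurable_const (by fun_prop))]
    congr 1
    ext x
    simp only [Set.preimage_ofPred_eq, Set.mem_ofPred_eq]
    have : |√(v : ℝ) * x| ^ 16 = (v : ℝ) ^ 8 * |x| ^ 16 := by
      rw [abs_mul, abs_of_nonneg (Real.sqrt_nonneg _), mul_pow,
        show (16 : ℕ) = 2 * 8 by norm_num, pow_mul, Real.sq_sqrt v.coe_nonneg]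
    rw [this]
  rw [hset, ← ENNReal.ofReal_toReal (measure_ne_top (gaussianReal 0 1) _)]
  refine ENNReal.ofReal_le_ofReal ?_
  rw [le_div_iff₀ hc]
  change (gaussianReal 0 1).real _ * c ≤ _
  linarith

lemma summable_one_div_one_add_abs_int_sq :
    Summable fun j : ℤ => 1 / (1 + |(j : ℝ)|) ^ 2 := by
  have h : Summable fun n : ℕ => 1 / (1 + (n : ℝ)) ^ 2 := by
    have := (summable_nat_add_iff 1).2 (Real.summable_one_div_nat_pow.2 (one_lt_two))
    simpa [add_comm] using this
  refine Summable.of_nat_of_neg ?_ ?_ <;> simpa using h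

lemma DyadicIncrementBound.comp_neg {w : ℝ → ℝ} (h : DyadicIncrementBound w) :
    DyadicIncrementBound fun t => w (-t) := by
  obtain ⟨C, hC, H⟩ := h
  refine ⟨C * 4, by positivity, fun n j => ?_⟩
  have h1 := H n (-j - 1)
  push_cast at h1
  rw [sub_add_cancel, abs_sub_comm, neg_div, ← neg_add', neg_div] at h1
  refine h1.trans ?_
  rw [abs_neg, mul_assoc]
  refine mul_le_mul_of_nonneg_left ?_ hC
  have h2 : 1 + |(j : ℝ) + 1| ≤ 2 * (1 + |(j : ℝ)|) := by
    have := abs_add_le (j : ℝ) 1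
    rw [abs_one] at this
    linarith [abs_nonneg (j : ℝ)]
  have h3 : (1 + |(j : ℝ) + 1|) ^ 2 ≤ (2 * (1 + |(j : ℝ)|)) ^ 2 := by gcongr
  have h4 : (0 : ℝ) ≤ ((39 / 50 : ℝ) ^ 16) ^ n := by positivity
  generalize ((39 / 50 : ℝ) ^ 16) ^ n = q at h4 ⊢
  rw [← mul_div_assoc]
  refine div_le_div_of_nonneg_right ?_ (by positivity)
  nlinarith [mul_le_mul_of_nonneg_left h3 h4]

lemma continuous_eval_pathSpace (t : ℝ) : Continuous fun ω : PathSpace => ω.1 t :=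
  (ContinuousEvalConst.continuous_eval_const t).comp continuous_subtype_val

namespace IsWienerMeasure

variable {P : Measure PathSpace}

lemma map_sub (hP : IsWienerMeasure P) (s t : ℝ) :
    P.map (fun ω : PathSpace => ω.1 t - ω.1 s) = gaussianReal 0 |t - s|.toNNReal := by
  rcases le_total s t with h | h
  · rw [hP.gaussian_increments s t h, abs_of_nonneg (by linarith)]
  · have h1 := hP.gaussian_increments t s h
    have hm : Measurable fun ω : PathSpace => ω.1 s - ω.1 t :=
      ((continuous_eval_pathSpace s).sub (continuous_eval_pathSpace t)).measurable
    rw [abs_of_nonpos (by linarith), neg_sub]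
    have h2 : (fun ω : PathSpace => ω.1 t - ω.1 s) =
        (fun x : ℝ => -x) ∘ fun ω : PathSpace => ω.1 s - ω.1 t := by ext ω; simp
    rw [h2, ← Measure.map_map measurable_neg hm, h1, gaussianReal_map_neg, neg_zero]

lemma measure_increment (hP : IsWienerMeasure P) (s t : ℝ) {A : Set ℝ} (hA : MeasurableSet A) :
    P {ω | ω.1 t - ω.1 s ∈ A} = gaussianReal 0 |t - s|.toNNReal A := by
  have hm : Measurable fun ω : PathSpace => ω.1 t - ω.1 s :=
    ((continuous_eval_pathSpace t).sub (continuous_eval_pathSpace s)).measurable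
  rw [← hP.map_sub s t, Measure.map_apply hm hA]
  rfl

lemma measure_increment_tail_le (hP : IsWienerMeasure P) (s t : ℝ) {c : ℝ} (hc : 0 < c) :
    P {ω | c ≤ |ω.1 t - ω.1 s| ^ 16} ≤
      ENNReal.ofReal ((∫ x, |x| ^ 16 ∂(gaussianReal 0 1)) * |t - s| ^ 8 / c) := by
  have := hP.measure_increment s t (A := {x | c ≤ |x| ^ 16})
    (measurableSet_le measurable_const (by fun_prop))
  have h2 := gaussianReal_tail_le |t - s|.toNNReal hc
  rw [Real.coe_toNNReal _ (abs_nonneg _)] at h2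
  exact this.trans_le h2

lemma ae_dyadicIncrementBound (hP : IsWienerMeasure P) :
    ∀ᵐ ω : PathSpace ∂P, DyadicIncrementBound ω.1 := by
  set M := ∫ x, |x| ^ 16 ∂(gaussianReal 0 1)
  have hM : 0 ≤ M := integral_nonneg fun x => by positivity
  obtain ⟨ρ, hρ⟩ : ∃ ρ : ℝ, ρ = (39 / 50) ^ 16 := ⟨_, rfl⟩
  have hρ0 : 0 < ρ := by rw [hρ]; positivity
  have hq1 : 1 / (64 * ρ) < 1 := by
    rw [div_lt_one (by positivity), hρ]; norm_num
  set c : ℕ × ℤ → ℝ := fun i => ρ ^ i.1 * (1 + |(i.2 : ℝ)|) ^ 2 / 4 ^ i.1 with hc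
  have hcpos : ∀ i, 0 < c i := fun i => by positivity
  have hsum : Summable fun i : ℕ × ℤ => M * ((1 / (64 * ρ)) ^ i.1 * (1 / (1 + |(i.2 : ℝ)|) ^ 2)) :=
    ((summable_geometric_of_lt_one (by positivity) hq1).mul_of_nonneg
      summable_one_div_one_add_abs_int_sq (fun n => by positivity)
      (fun j => by positivity)).mul_left M
  have key := ae_exists_forall_le_of_summable (P := P)
    (X := fun (i : ℕ × ℤ) (ω : PathSpace) =>
      |ω.1 ((i.2 + 1) / 2 ^ i.1) - ω.1 (i.2 / 2 ^ i.1)| ^ 16 / c i) hsum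
    (fun i => ?_)
  · filter_upwards [key] with ω ⟨C, hC, H⟩
    refine ⟨C, hC, fun n j => ?_⟩
    rw [← hρ]
    exact (div_le_iff₀ (hcpos (n, j))).1 (H (n, j))
  · have h1 := hP.measure_increment_tail_le ((i.2 : ℝ) / 2 ^ i.1) ((i.2 + 1) / 2 ^ i.1) (hcpos i)
    have h2 : {ω : PathSpace | 1 ≤
        |ω.1 ((i.2 + 1) / 2 ^ i.1) - ω.1 (i.2 / 2 ^ i.1)| ^ 16 / c i} =
        {ω | c i ≤ |ω.1 ((i.2 + 1) / 2 ^ i.1) - ω.1 (i.2 / 2 ^ i.1)| ^ 16} := by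
      ext ω
      simp only [Set.mem_ofPred_eq]
      rw [one_le_div (hcpos i)]
    rw [h2]
    refine h1.trans (ENNReal.ofReal_le_ofReal (le_of_eq ?_))
    have h3 : |((i.2 : ℝ) + 1) / 2 ^ i.1 - i.2 / 2 ^ i.1| ^ 8 = (1 / 256) ^ i.1 := by
      rw [← sub_div, add_sub_cancel_left, abs_of_pos (by positivity), div_pow, one_pow, ← pow_mul,
        mul_comm i.1, pow_mul, one_div_pow]
      norm_num
    rw [h3]
    simp only [hc]
    have h4 : (1 / (64 * ρ)) ^ i.1 = (1 / 256) ^ i.1 * 4 ^ i.1 / ρ ^ i.1 := by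
      rw [← mul_pow, ← div_pow]
      congr 1
      field_simp
      norm_num
    rw [h4]
    field_simp
    rfl

lemma ae_integer_bound (hP : IsWienerMeasure P) :
    ∀ᵐ ω : PathSpace ∂P, ∃ C : ℝ, 0 ≤ C ∧ ∀ m : ℤ, |ω.1 m| ^ 16 ≤ C * (1 + |(m : ℝ)|) ^ 10 := by
  set M := ∫ x, |x| ^ 16 ∂(gaussianReal 0 1)
  have hM : 0 ≤ M := integral_nonneg fun x => by positivity
  have hcpos : ∀ m : ℤ, 0 < (1 + |(m : ℝ)|) ^ 10 := fun m => by positivity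
  have key := ae_exists_forall_le_of_summable (P := P)
    (X := fun (m : ℤ) (ω : PathSpace) => |ω.1 m| ^ 16 / (1 + |(m : ℝ)|) ^ 10)
    (summable_one_div_one_add_abs_int_sq.mul_left M) (fun m => ?_)
  · filter_upwards [key] with ω ⟨C, hC, H⟩
    refine ⟨C, hC, fun m => ?_⟩
    have := H m
    rwa [div_le_iff₀ (hcpos _)] at this
  · have h1 := hP.measure_increment_tail_le 0 m (hcpos m)
    have h2 : {ω : PathSpace | 1 ≤ |ω.1 m| ^ 16 / (1 + |(m : ℝ)|) ^ 10} =
        {ω | (1 + |(m : ℝ)|) ^ 10 ≤ |ω.1 m - ω.1 0| ^ 16} := by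
      ext ω
      simp only [Set.mem_ofPred_eq]
      rw [one_le_div (hcpos m), ω.2, sub_zero]
    rw [h2]
    refine h1.trans (ENNReal.ofReal_le_ofReal ?_)
    rw [sub_zero, mul_div_assoc]
    refine mul_le_mul_of_nonneg_left ?_ hM
    rw [div_le_div_iff₀ (hcpos m) (by positivity), one_mul]
    calc |(m : ℝ)| ^ 8 * (1 + |(m : ℝ)|) ^ 2 ≤ (1 + |(m : ℝ)|) ^ 8 * (1 + |(m : ℝ)|) ^ 2 := by
          gcongr; linarith
      _ = _ := by ring

lemma iIndepFun_increments_of_antitone (hP : IsWienerMeasure P) {u : ℕ → ℝ} (hu : Antitone u) :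
    iIndepFun (fun k (ω : PathSpace) => ω.1 (u (k + 1)) - ω.1 (u k)) P := by
  refine iIndepFun_iff_finset.2 fun s => ?_
  have hlt : ∀ x : s, x.1 < s.sup id + 1 := fun x =>
    Nat.lt_add_one_of_le (Finset.le_sup (f := id) x.2)
  set n := s.sup id + 1
  have h := hP.indep_increments n (fun i => u (n - i)) fun i j hij => hu (by
    have : (i : ℕ) ≤ j := hij
    omega)
  have h' := (h.precomp (g := fun x : s => (⟨n - 1 - x.1, by have := hlt x; omega⟩ : Fin n))
    (fun x y hxy => by
      have h1 := hlt x
      have h2 := hlt y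
      simp only [Fin.mk.injEq] at hxy
      exact Subtype.ext (by omega))).comp (fun _ x => -x) fun _ => measurable_neg
  convert! h' using 1
  ext x ω
  have h1 := hlt x
  simp only [Finset.restrict, Function.comp_apply, Fin.val_succ, Fin.val_castSucc]
  rw [show n - (n - 1 - x.1 + 1) = x.1 by omega, show n - (n - 1 - x.1) = x.1 + 1 by omega]
  ring

lemma ae_frequently_le_increment (hP : IsWienerMeasure P) {u : ℕ → ℝ}
    (hne : ∀ k, u (k + 1) ≠ u k)
    (hind : iIndepFun (fun k (ω : PathSpace) => ω.1 (u (k + 1)) - ω.1 (u k)) P) :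
    ∀ᵐ ω : PathSpace ∂P, ∃ᶠ k : ℕ in atTop,
      √|u (k + 1) - u k| ≤ ω.1 (u (k + 1)) - ω.1 (u k) := by
  have := hP.isProbabilityMeasure
  set s : ℕ → Set PathSpace := fun k =>
    (fun ω : PathSpace => ω.1 (u (k + 1)) - ω.1 (u k)) ⁻¹' Set.Ici √|u (k + 1) - u k| with hs
  have hmeas : ∀ k, Measurable fun ω : PathSpace => ω.1 (u (k + 1)) - ω.1 (u k) := fun k =>
    ((continuous_eval_pathSpace _).sub (continuous_eval_pathSpace _)).measurable
  have hsm : ∀ k, MeasurableSet (s k) := fun k => hmeas k measurableSet_Ici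
  have hprob : ∀ k, P (s k) = gaussianReal 0 1 (Set.Ici 1) := by
    intro k
    refine (hP.measure_increment (u k) (u (k + 1)) measurableSet_Ici).trans ?_
    rw [gaussianReal_zero_eq_map, Measure.map_apply (by fun_prop) measurableSet_Ici,
      Real.coe_toNNReal _ (abs_nonneg _)]
    congr 1
    ext x
    have h0 : 0 < √|u (k + 1) - u k| :=
      Real.sqrt_pos.2 (abs_pos.2 (sub_ne_zero.2 (hne k)))
    simp only [Set.mem_preimage, Set.mem_Ici]
    exact le_mul_iff_one_le_right h0
  have hpos : gaussianReal 0 1 (Set.Ici (1 : ℝ)) ≠ 0 := by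
    intro h
    have := gaussianReal_absolutelyContinuous' 0 one_ne_zero h
    simp at this
  have hindep : iIndepSet s P := by
    rw [iIndepSet_iff_meas_biInter hsm]
    intro S
    exact hind.measure_inter_preimage_eq_mul S fun k _ => measurableSet_Ici
  have h1 := measure_limsup_eq_one hsm hindep (by
    simp_rw [hprob]
    exact ENNReal.tsum_const_eq_top_of_ne_zero hpos)
  have h2 : ∀ᵐ ω ∂P, ω ∈ limsup s atTop :=
    (mem_ae_iff_prob_eq_one (MeasurableSet.measurableSet_limsup hsm)).2 h1
  filter_upwards [h2] with ω hω
  exact mem_limsup_iff_frequently_mem.1 hω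

lemma ae_isRegularPath (hP : IsWienerMeasure P) {δ : ℝ} (hδ : 0 ≤ δ) :
    ∀ᵐ ω : PathSpace ∂P, IsRegularPath δ ω.1 := by
  have hlt : ∀ k : ℕ, (2 : ℝ) ^ 3 ^ k < 2 ^ 3 ^ (k + 1) := fun k =>
    pow_lt_pow_right₀ (by norm_num) (Nat.pow_lt_pow_right (by norm_num) (Nat.lt_succ_self k))
  have hmono : Monotone fun k : ℕ => (2 : ℝ) ^ 3 ^ k := monotone_nat_of_le_succ fun k => (hlt k).le
  filter_upwards [hP.ae_dyadicIncrementBound, hP.ae_integer_bound,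
    hP.ae_frequently_le_increment (u := fun k => 2 ^ 3 ^ k) (fun k => (hlt k).ne')
      (hP.indep_increments.nat hmono),
    hP.ae_frequently_le_increment (u := fun k => -2 ^ 3 ^ k)
      (fun k h => (hlt k).ne' (neg_inj.1 h)) (hP.iIndepFun_increments_of_antitone hmono.neg)]
    with ω hD hI hF hB
  have hw : Continuous ω.1 := ω.1.continuous
  have hg := hD.sublinearGrowth hw hI
  refine ⟨hD.vanishingCubicVariation hw, hg,
    not_integrableOn_exp_Ioi hw hδ (hD.frequently_nonneg hw hg ?_),
    not_integrableOn_exp_Iic hw hδ ?_⟩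
  · refine hF.mono fun k hk => ?_
    rwa [abs_of_pos (sub_pos.2 (hlt k))] at hk
  · refine hD.comp_neg.frequently_nonneg (by fun_prop) hg.comp_neg (hB.mono fun k hk => ?_)
    rwa [neg_sub_neg, abs_of_neg (sub_neg.2 (hlt k)), neg_sub] at hk

end IsWienerMeasure

theorem theorem4p1 (P : Measure PathSpace) (hP : IsWienerMeasure P) (δ : ℝ) (hδ : 0 < δ) :
    -- a shift-invariant set of full measure, depending neither on `β` nor on `lam`
    ∃ Ω' : Set PathSpace, (∀ t : ℝ, wienerShift t ⁻¹' Ω' = Ω') ∧ (∀ᵐ ω ∂P, ω ∈ Ω') ∧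
      ∀ (β : ℝ → ℝ) (β₀ β₁ : ℝ), ContDiff ℝ (⊤ : ℕ∞) β → 0 < β₀ →
        (∀ t, β₀ ≤ β t ∧ β t ≤ β₁) →
        -- well-posedness: uniqueness for all data, forward existence for nonnegative data
        (∀ lam : ℝ, ∀ ω ∈ Ω', ∀ a b x₀ : ℝ, a ≤ b →
          (0 ≤ x₀ → SolutionExists lam δ β ω a b x₀) ∧
          (∀ x y : ℝ → ℝ, IsStratonovichSolution lam δ β ω a b x₀ x →
            IsStratonovichSolution lam δ β ω a b x₀ y → Set.EqOn x y (Set.Icc a b))) ∧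
        -- `lam < 0`
        (∀ lam : ℝ, lam < 0 →
          IsRandomCompleteQuasiSolution lam δ β Ω' (fun _ _ => 0) ∧
          IsRandomCompleteQuasiSolution lam δ β Ω' (bifurcatingSolution lam δ β) ∧
          PullbackAsymptoticallyStable (solutionCocycle lam δ β) 0 (Set.Ioi 0) Ω' ∧
          (∀ K : Set ℝ, IsCompact K → K ⊆ Set.Ioi 0 →
            PullbackAttracts (solutionCocycle lam δ β) (fun _ _ => 0) K Ω') ∧
          (∀ τ : ℝ, ∀ ω ∈ Ω', bifurcatingSolution lam δ β τ ω < 0)) ∧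
        (∀ τ : ℝ, ∀ ω ∈ Ω',
          Tendsto (fun lam : ℝ => bifurcatingSolution lam δ β τ ω) (𝓝[<] 0) (𝓝 0)) ∧
        -- `lam > 0`
        (∀ lam : ℝ, 0 < lam →
          IsRandomCompleteQuasiSolution lam δ β Ω' (fun _ _ => 0) ∧
          IsRandomCompleteQuasiSolution lam δ β Ω' (bifurcatingSolution lam δ β) ∧
          (∀ τ : ℝ, ∀ ω ∈ Ω',
            ¬ PullbackLyapunovStableAt (solutionCocycle lam δ β) 0 (Set.Ioi 0) τ ω) ∧
          (∀ K : Set ℝ, IsCompact K → K ⊆ Set.Ioi 0 →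
            PullbackAttracts (solutionCocycle lam δ β) (bifurcatingSolution lam δ β) K Ω') ∧
          (∀ τ : ℝ, ∀ ω ∈ Ω', 0 < bifurcatingSolution lam δ β τ ω)) ∧
        (∀ τ : ℝ, ∀ ω ∈ Ω',
          Tendsto (fun lam : ℝ => bifurcatingSolution lam δ β τ ω) (𝓝[>] 0) (𝓝 0)) := by
  have hδ' : δ ≠ 0 := hδ.ne'
  refine ⟨{ω | IsRegularPath δ ω.1}, preimage_wienerShift_isRegularPath δ,
    hP.ae_isRegularPath hδ.le, fun β β₀ β₁ hβs hβ₀ hb => ?_⟩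
  have hβ : Continuous β := hβs.continuous
  have hβ0 : ∀ t, 0 ≤ β t := fun t => hβ₀.le.trans (hb t).1
  have hzero : ∀ lam : ℝ,
      IsRandomCompleteQuasiSolution lam δ β {ω | IsRegularPath δ ω.1} (fun _ _ => 0) := fun lam =>
    ⟨fun _ => measurable_const, fun t ht τ ω hω => (cocycle_zero hδ' hβ hω ht).1,
      fun t ht τ ω hω => (cocycle_zero hδ' hβ hω ht).2⟩
  refine ⟨fun lam ω hω a b x₀ hab => ⟨fun hx => ?_, fun x y hx hy => hx.eqOn hβ hω.cubic hy⟩,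
    fun lam hlam => ⟨hzero lam, ⟨measurable_bifurcatingSolution hβ, ?_, ?_⟩, ⟨?_, ?_⟩, ?_, ?_⟩,
    fun τ ω hω => tendsto_bifurcatingSolution_nhdsLT hβ hβ₀ hb hω τ,
    fun lam hlam => ⟨hzero lam, ⟨measurable_bifurcatingSolution hβ, ?_, ?_⟩, ?_, ?_, ?_⟩,
    fun τ ω hω => tendsto_bifurcatingSolution_nhdsGT hβ hβ₀ hb hω τ⟩
  · exact ⟨_, isStratonovichSolution_logisticFlow hδ' hβ hω.cubic fun t ht =>
      logisticDenom_pos_of_nonneg hβ0 ht.1 hx⟩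
  · exact fun t ht τ ω hω => (cocycle_bifurcatingSolution_of_neg hδ' hβ hβ₀ hb hω hlam ht τ).1
  · exact fun t ht τ ω hω => (cocycle_bifurcatingSolution_of_neg hδ' hβ hβ₀ hb hω hlam ht τ).2
  · exact fun τ ω hω => pullbackLyapunovStableAt_of_neg hδ' hβ hβ0 hω hlam τ
  · exact fun τ ω hω x hx => tendsto_of_pullbackAttracts_singleton
      (pullbackAttracts_zero_of_neg hδ' hβ hβ0 hlam isCompact_singleton
        (Set.singleton_subset_iff.2 hx)) τ hω
  · exact fun K hK hK0 => pullbackAttracts_zero_of_neg hδ' hβ hβ0 hlam hK hK0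
  · exact fun τ ω hω => bifurcatingSolution_neg hβ hβ₀ hb hω hlam τ
  · exact fun t ht τ ω hω => (cocycle_bifurcatingSolution_of_pos hδ' hβ hβ₀ hb hω hlam ht τ).1
  · exact fun t ht τ ω hω => (cocycle_bifurcatingSolution_of_pos hδ' hβ hβ₀ hb hω hlam ht τ).2
  · exact fun τ ω hω => not_pullbackLyapunovStableAt_of_pos hδ' hβ hβ₀ hb hω hlam τ
  · exact fun K hK hK0 => pullbackAttracts_bifurcatingSolution hδ' hβ hβ₀ hb hlam hK hK0
  · exact fun τ ω hω => bifurcatingSolution_pos hβ hβ₀ hb hω hlam τ
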